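/- Let $n\geqslant 1$ and $\sigma>0$. Consider on $[0,\infty)\times\mathbb{R}^n$ the Cauchy problem for the thermoelastic plate system with Newton's law of cooling $$u_{tt}+\Delta^2u+\Delta\theta=0,\qquad \theta_t-\Delta\theta+\sigma\theta-\Delta u_t=0,\qquad (u,u_t,\theta)(0,\cdot)=(u_0,u_1,\theta_0),$$ with $u_0,u_1,\theta_0\in L^2(\mathbb{R}^n)\cap L^1(\mathbb{R}^n)$. A solution is a pair $(u,\theta)$ such that $u\in\mathcal{C}([0,\infty);L^2(\mathbb{R}^n))$, $u$, $u_t$ and $\theta$ are differentiable in time on $[0,\infty)$ as curves in the space of tempered distributions (tested against Schwartz functions, one-sidedly at $t=0$), and the equations hold in the sense of tempered distributions at every $t\geqslant 0$, with the given initial values. Put $P_{u_1}:=\int_{\mathbb{R}^n}u_1(x)\,\mathrm{d}x$, let $$\|(u_0,u_1,\theta_0)\|_{(L^2\cap L^1)^3}:=\|u_0\|_{L^2}+\|u_0\|_{L^1}+\|u_1\|_{L^2}+\|u_1\|_{L^1}+\|\theta_0\|_{L^2}+\|\theta_0\|_{L^1},$$ and $$\mathcal{D}_n(t):=\begin{cases}t^{1-\frac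 n4}&\text{if } n\leqslant 3,\\ \sqrt{\ln t}&\text{if } n=4,\\ t^{\frac12-\frac n8}&\text{if } n\geqslant 5.\end{cases}$$ Then there are constants $c,C>0$ and $T$, depending only on $n$ and $\sigma$, such that for all such data and every solution $(u,\theta)$: 1. $\|u(t,\cdot)\|_{L^2}\leqslant C\,\mathcal{D}_n(t)\,\|(u_0,u_1,\theta_0)\|_{(L^2\cap L^1)^3}$ for all $t\geqslant T$; 2. $c\,\mathcal{D}_n(t)\,|P_{u_1}|\leqslant\|u(t,\cdot)\|_{L^2}$ for all sufficiently large $t$ (how large may depend on the solution); 3. consequently, if $P_{u_1}\neq0$, then $\|u(t,\cdot)\|_{L^2}\simeq\mathcal{D}_n(t)$ as $t\to\infty$, i.e. each side is bounded by a constant multiple of the other for all sufficiently large $t$. -/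

import Mathlib

open MeasureTheory Filter Asymptotics
open scoped SchwartzMap Laplacian

/-- `f'` is the time derivative of the curve `f : [0,∞) → 𝓢'(ℝⁿ)` of tempered distributions
(one-sided at `t = 0`), tested against Schwartz functions. Values at `t < 0` play no role. -/
def HasTimeDeriv {n : ℕ} (f f' : ℝ → 𝓢'(EuclideanSpace ℝ (Fin n), ℂ)) : Prop :=
  ∀ φ : 𝓢(EuclideanSpace ℝ (Fin n), ℂ), ∀ t : ℝ, 0 ≤ t →
    HasDerivWithinAt (fun s => f s φ) (f' t φ) (Set.Ici 0) t

/-- `(u, θ)`, with velocity `ut = ∂ₜu`, solves the Cauchy problem for the thermoelastic plate system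
with Newton's law of cooling
`uₜₜ + Δ²u + Δθ = 0`, `θₜ - Δθ + σθ - Δuₜ = 0`, `(u, uₜ, θ)(0) = (u₀, u₁, θ₀)`
on `[0,∞) × ℝⁿ`. The displacement is a continuous curve in `L²(ℝⁿ)`; velocity and temperature are
curves of tempered distributions (for `u₀` merely in `L²` they lie in `H⁻²` but are not bounded in
`L²` as `t → 0`), and the equations hold in `𝓢'(ℝⁿ)` at every time `t ≥ 0`. -/
structure IsThermoelasticPlateSolution {n : ℕ} (σ : ℝ)
    (u₀ u₁ θ₀ : Lp ℂ 2 (volume : Measure (EuclideanSpace ℝ (Fin n))))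
    (u : ℝ → Lp ℂ 2 (volume : Measure (EuclideanSpace ℝ (Fin n))))
    (ut θ : ℝ → 𝓢'(EuclideanSpace ℝ (Fin n), ℂ)) : Prop where
  continuousOn : ContinuousOn u (Set.Ici 0)
  velocity : HasTimeDeriv (fun t => Lp.toTemperedDistribution (u t)) ut
  plate : ∃ utt : ℝ → 𝓢'(EuclideanSpace ℝ (Fin n), ℂ), HasTimeDeriv ut utt ∧
    ∀ t : ℝ, 0 ≤ t → utt t + Δ (Δ (Lp.toTemperedDistribution (u t))) + Δ (θ t) = 0
  heat : ∃ θt : ℝ → 𝓢'(EuclideanSpace ℝ (Fin n), ℂ), HasTimeDeriv θ θt ∧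
    ∀ t : ℝ, 0 ≤ t → θt t - Δ (θ t) + (σ : ℂ) • θ t - Δ (ut t) = 0
  displacement_zero : u 0 = u₀
  velocity_zero : ut 0 = Lp.toTemperedDistribution u₁
  temperature_zero : θ 0 = Lp.toTemperedDistribution θ₀

/-- The norm of `L² ∩ L¹` (for `f ∈ L²` that is also integrable). -/
noncomputable def normL2L1 {n : ℕ} (f : Lp ℂ 2 (volume : Measure (EuclideanSpace ℝ (Fin n)))) : ℝ :=
  ‖f‖ + ∫ x, ‖f x‖

/-- The growth (`n ≤ 4`) or decay (`n ≥ 5`) rate `𝓓ₙ(t)`, used for large `t`. -/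
noncomputable def rateD (n : ℕ) (t : ℝ) : ℝ :=
  if n ≤ 3 then t ^ (1 - (n : ℝ) / 4)
  else if n = 4 then Real.sqrt (Real.log t)
  else t ^ ((1 : ℝ) / 2 - (n : ℝ) / 8)

open scoped FourierTransform

/-! On the Fourier side the system decouples into one linear ODE per frequency, with parameter `ρ =
|2πξ|²`. For small `ρ` the displacement behaves like `sin(ρt)/ρ` times `û₁(ξ)`, damped at a rate
comparable to `ρ²`; for `ρ ≥ 1` it decays exponentially, uniformly in `ρ`. By Plancherel the
question is the size of `∫ r^(n-1) sin²(ρt)/ρ² dr` with `ρ ~ r²`, cut off at `ρ²t ~ 1`. For `n ≤ 3`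
the mass sits at `ρ ~ 1/t`, for `n ≥ 5` at `ρ ~ t^(-1/2)`, and for `n = 4` every dyadic annulus
between these scales contributes equally, which produces `log t`.

Upper bound: a Lyapunov functional gives `energy_decay`. It bounds `ρ|û|`, and integrating the
velocity bounds `|û|` by a multiple of `t`. `exists_low_freq_majorant` integrates the combination of
the two.

Lower bound: only the zone `ρ²t ≤ σ/16` is needed. There `θ` is slaved to the velocity, so the
half-waves `v ± iρu` are nearly free and `le_norm_u` shows the `sin(ρt)` profile without spectral
expansions. The oscillation is averaged over an annulus by an explicit primitive
(`exists_le_integral_oscWeight`), and continuity of `û₁` at `0` brings in the integral of `u₁`.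

Both bounds need every solution to be the explicit one. Solutions are only distributional in `uₜ`
and `θ`, so `weak_plate_unique` works with the single a priori bound available, that of `u` in `L²`;
`fourier_ae_eq` is the resulting representation. -/

/-- One Fourier mode of the thermoelastic plate system: the ODE system solved by
`(û, ûₜ, θ̂)(·, ξ)` when `ρ = |2πξ|²`. -/
structure IsPlateMode {F : Type*} [NormedAddCommGroup F] [NormedSpace ℝ F] (ρ σ : ℝ)
    (u v θ : ℝ → F) : Prop where
  deriv_u : ∀ t, HasDerivAt u (v t) t
  deriv_v : ∀ t, HasDerivAt v (-(ρ ^ 2 • u t) + ρ • θ t) t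
  deriv_θ : ∀ t, HasDerivAt θ (-((ρ + σ) • θ t) - ρ • v t) t

namespace IsPlateMode

section Map

variable {F G : Type*} [NormedAddCommGroup F] [NormedSpace ℝ F] [NormedAddCommGroup G]
  [NormedSpace ℝ G] {ρ σ : ℝ} {u v θ : ℝ → F}

theorem map (h : IsPlateMode ρ σ u v θ) (l : F →L[ℝ] G) :
    IsPlateMode ρ σ (fun t => l (u t)) (fun t => l (v t)) (fun t => l (θ t)) where
  deriv_u t := l.hasFDerivAt.comp_hasDerivAt t (h.deriv_u t)
  deriv_v t := by
    simpa [Function.comp_def] using l.hasFDerivAt.comp_hasDerivAt t (h.deriv_v t)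
  deriv_θ t := by
    simpa [Function.comp_def] using l.hasFDerivAt.comp_hasDerivAt t (h.deriv_θ t)

end Map

/-! ### Energy decay of a single mode by a Lyapunov functional -/

section Energy

variable {ρ σ : ℝ}

/-- The left side is the time derivative of the functional in `energy_decay_real`, with `w = ρu`.
Young's inequality splits the two cross terms so that half of the damping of `v` and `w` survives;
the `θ` terms are absorbed by `-2sθ²` because `β ≤ s/4`. -/
theorem lyapunov_dissipation {ρ s β : ℝ} (hs : 0 < s) (hρ : 0 ≤ ρ) (hρs : ρ ≤ s)
    (hβ : 4 * s * β = ρ ^ 2) (w v θ : ℝ) :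
    -2 * s * θ ^ 2 + β * θ ^ 2 - β / 2 * (w * θ) - ρ / 4 * (v * θ) - β / 2 * (v ^ 2 + w ^ 2)
      ≤ -(β / 4) * (v ^ 2 + w ^ 2 + θ ^ 2) := by
  have hβ0 : 0 ≤ β := by
    by_contra! h
    nlinarith [sq_nonneg ρ, mul_pos hs (neg_pos.2 h)]
  have hβs : β ≤ s / 4 := by
    have : 4 * s * β ≤ s * s := by nlinarith
    nlinarith
  have h1 : -(β / 2 * (w * θ)) ≤ β / 4 * w ^ 2 + β / 4 * θ ^ 2 := by
    nlinarith [mul_nonneg hβ0 (sq_nonneg (w + θ))]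
  have h2 : -(ρ / 4 * (v * θ)) ≤ β / 4 * v ^ 2 + s / 4 * θ ^ 2 := by
    have h3 : 0 ≤ (ρ * v + 2 * s * θ) ^ 2 := sq_nonneg _
    have h4 : (ρ * v + 2 * s * θ) ^ 2
        = 16 * s * (β / 4 * v ^ 2 + s / 4 * θ ^ 2 + ρ / 4 * (v * θ)) := by
      linear_combination (-v ^ 2) * hβ
    rw [h4] at h3
    have := nonneg_of_mul_nonneg_right h3 (by positivity)
    linarith
  nlinarith [mul_nonneg (sub_nonneg.2 hβs) (sq_nonneg θ), mul_nonneg hs.le (sq_nonneg θ)]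

/-- The bare energy dissipates only through `θ`: its derivative is `-2(ρ+σ)θ²`. Adding `α·vθ`
creates damping of `v` through the coupling, and adding `(β/2)·uv` trades half of it for damping of
`ρu`. Both corrections are small against the energy, so the modified functional is equivalent to it.
-/
theorem energy_decay_real {u v θ : ℝ → ℝ} (h : IsPlateMode ρ σ u v θ) (hσ : 0 < σ) (hρ : 0 ≤ ρ)
    {t : ℝ} (ht : 0 ≤ t) :
    (v t) ^ 2 + (ρ * u t) ^ 2 + (θ t) ^ 2 ≤
      2 * Real.exp (-(ρ ^ 2 / (20 * (ρ + σ)) * t)) *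
        ((v 0) ^ 2 + (ρ * u 0) ^ 2 + (θ 0) ^ 2) := by
  have hs : 0 < ρ + σ := by linarith
  set s := ρ + σ with hsdef
  set β := ρ ^ 2 / (4 * s) with hβdef
  set α := ρ / (4 * s) with hαdef
  have hβ : 4 * s * β = ρ ^ 2 := by rw [hβdef]; field_simp
  have hα : 4 * s * α = ρ := by rw [hαdef]; field_simp
  have hαβ : α * ρ = β := by rw [hαdef, hβdef]; field_simp
  have hα0 : 0 ≤ α := by positivity
  have hβ0 : 0 ≤ β := by positivity
  have hα4 : α ≤ 1 / 4 := by rw [hαdef, div_le_div_iff₀ (by positivity) (by norm_num)]; linarith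
  have hκ : ρ ^ 2 / (20 * s) = β / 5 := by rw [hβdef]; field_simp; ring
  rw [hκ]
  let E : ℝ → ℝ := fun r => (v r) ^ 2 + (ρ * u r) ^ 2 + (θ r) ^ 2
  let Λ : ℝ → ℝ := fun r => E r + α * (v r * θ r) + β / 2 * (u r * v r)
  have hΛ : ∀ r, 3 / 4 * E r ≤ Λ r ∧ Λ r ≤ 5 / 4 * E r := by
    intro r
    have h1 : |α * (v r * θ r)| ≤ 1 / 8 * E r := by
      rw [abs_mul, abs_of_nonneg hα0]
      have : |v r * θ r| ≤ E r / 2 := by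
        rw [abs_le]
        constructor <;> simp only [E] <;> nlinarith [sq_nonneg (v r + θ r), sq_nonneg (v r - θ r), sq_nonneg (ρ * u r)]
      calc α * |v r * θ r| ≤ 1 / 4 * (E r / 2) := by gcongr
        _ = _ := by ring
    have h2 : |β / 2 * (u r * v r)| ≤ 1 / 8 * E r := by
      have e : β / 2 * (u r * v r) = α / 2 * ((ρ * u r) * v r) := by rw [← hαβ]; ring
      rw [e, abs_mul, abs_of_nonneg (by positivity : 0 ≤ α / 2)]
      have : |(ρ * u r) * v r| ≤ E r / 2 := by
        rw [abs_le]
        constructor <;> simp only [E] <;> nlinarith [sq_nonneg (ρ * u r + v r), sq_nonneg (ρ * u r - v r), sq_nonneg (θ r)]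
      have hE : 0 ≤ E r := by positivity
      calc α / 2 * |(ρ * u r) * v r| ≤ (1 / 4) / 2 * (E r / 2) := by gcongr
        _ ≤ _ := by linarith
    rw [abs_le] at h1 h2
    constructor <;> simp only [Λ] <;> linarith
  let Λ' : ℝ → ℝ := fun r => -2 * s * θ r ^ 2 + β * θ r ^ 2 - β / 2 * ((ρ * u r) * θ r)
    - ρ / 4 * (v r * θ r) - β / 2 * (v r ^ 2 + (ρ * u r) ^ 2)
  have hder : ∀ r, HasDerivAt Λ (Λ' r) r := by
    intro r
    have hu := h.deriv_u r
    have hv := h.deriv_v r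
    have hθ := h.deriv_θ r
    simp only [smul_eq_mul] at hv hθ
    have := ((((hv.pow 2).add ((hu.const_mul ρ).pow 2)).add (hθ.pow 2)).add
      ((hv.mul hθ).const_mul α)).add ((hu.mul hv).const_mul (β / 2))
    convert! this using 1
    simp only [Λ']
    rw [← hsdef]
    push_cast
    rw [← hαβ]
    linear_combination (v r * θ r / 4) * hα
  -- The rate `β/5` is the dissipation `β/4` of `E` divided by the upper equivalence constant `5/4`.
  -- The final factor `2` bounds `(5/4)/(3/4)`.
  have hanti : Antitone fun r => Real.exp (β / 5 * r) * Λ r := by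
    apply antitone_of_hasDerivAt_nonpos
      (f' := fun r => Real.exp (β / 5 * r) * (β / 5 * Λ r + Λ' r))
    · intro r
      have he : HasDerivAt (fun r => Real.exp (β / 5 * r)) (Real.exp (β / 5 * r) * (β / 5)) r := by
        simpa using ((hasDerivAt_id r).const_mul (β / 5)).exp
      convert! he.mul (hder r) using 1
      ring
    · intro r
      have h1 : Λ' r ≤ -(β / 4) * E r := by
        have := lyapunov_dissipation hs hρ (by linarith) hβ (ρ * u r) (v r) (θ r)
        simpa only [Λ', E] using this
      have h2 := (hΛ r).2
      have : β / 5 * Λ r ≤ β / 5 * (5 / 4 * E r) := by gcongr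
      have : β / 5 * Λ r + Λ' r ≤ 0 := by linarith
      exact mul_nonpos_of_nonneg_of_nonpos (Real.exp_pos _).le this
  have h0 := hanti ht
  simp only [mul_zero, Real.exp_zero, one_mul] at h0
  have hpos := Real.exp_pos (-(β / 5 * t))
  have hΛt : Λ t ≤ Real.exp (-(β / 5 * t)) * Λ 0 := by
    have := mul_le_mul_of_nonneg_left h0 hpos.le
    rwa [← mul_assoc, ← Real.exp_add, neg_add_cancel, Real.exp_zero, one_mul] at this
  have hE0 : 0 ≤ E 0 := by positivity
  have h3 : Real.exp (-(β / 5 * t)) * Λ 0 ≤ Real.exp (-(β / 5 * t)) * (5 / 4 * E 0) := by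
    gcongr
    exact (hΛ 0).2
  change E t ≤ 2 * Real.exp (-(β / 5 * t)) * E 0
  nlinarith [(hΛ t).1, mul_nonneg hpos.le hE0]

/-- Exponential decay of the energy of a Fourier mode. -/
theorem energy_decay {u v θ : ℝ → ℂ} (h : IsPlateMode ρ σ u v θ) (hσ : 0 < σ) (hρ : 0 ≤ ρ)
    {t : ℝ} (ht : 0 ≤ t) :
    ‖v t‖ ^ 2 + (ρ * ‖u t‖) ^ 2 + ‖θ t‖ ^ 2 ≤
      2 * Real.exp (-(ρ ^ 2 / (20 * (ρ + σ)) * t)) *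
        (‖v 0‖ ^ 2 + (ρ * ‖u 0‖) ^ 2 + ‖θ 0‖ ^ 2) := by
  have h1 := (h.map Complex.reCLM).energy_decay_real hσ hρ ht
  have h2 := (h.map Complex.imCLM).energy_decay_real hσ hρ ht
  simp only [Complex.reCLM_apply, Complex.imCLM_apply] at h1 h2
  simp only [mul_pow, Complex.sq_norm, Complex.normSq_apply] at *
  linarith

theorem norm_u_le {u v θ : ℝ → ℂ} (h : IsPlateMode ρ σ u v θ) {B : ℝ} {t : ℝ} (ht : 0 ≤ t)
    (hB : ∀ s, 0 ≤ s → ‖v s‖ ≤ B) : ‖u t‖ ≤ ‖u 0‖ + B * t := by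
  have := image_norm_le_of_norm_deriv_right_le_deriv_boundary (a := 0) (b := t) (f := u) (f' := v)
    (B := fun r => ‖u 0‖ + B * r) (B' := fun _ => B)
    (fun r _ => (h.deriv_u r).continuousAt.continuousWithinAt)
    (fun r _ => (h.deriv_u r).hasDerivWithinAt) (by simp)
    (fun r => by simpa using ((hasDerivAt_id r).const_mul B).const_add ‖u 0‖)
    (fun r hr => hB r hr.1)
  exact this ⟨ht, le_rfl⟩

end Energy

/-! ### Nearly free oscillation of a mode for `ρ²t` small -/

section Wave

variable {ρ σ : ℝ} {u v θ : ℝ → ℂ}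

/-- Duhamel's formula for the heat equation with source `-ρv`. The factor `e^(-σs)` is kept because
its time integral is at most `1/σ`, so the initial temperature contributes an error that does not
grow with `t`. -/
theorem norm_θ_le (h : IsPlateMode ρ σ u v θ) (hσ : 0 < σ) (hρ : 0 ≤ ρ) {t m : ℝ} (hm0 : 0 ≤ m)
    (hm : ∀ s ∈ Set.Icc 0 t, ‖v s‖ ≤ m) {s : ℝ} (hs : s ∈ Set.Icc 0 t) :
    ‖θ s‖ ≤ Real.exp (-(σ * s)) * ‖θ 0‖ + ρ / σ * m := by
  set k := ρ + σ
  have hk : 0 < k := by simp only [k]; linarith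
  have hexp : ∀ r, HasDerivAt (fun r => Real.exp (k * r)) (Real.exp (k * r) * k) r := fun r => by
    simpa using ((hasDerivAt_id r).const_mul k).exp
  have hder : ∀ r, HasDerivAt (fun r => Real.exp (k * r) • θ r)
      (-(Real.exp (k * r) * ρ) • v r) r := by
    intro r
    convert! (hexp r).smul (h.deriv_θ r) using 1
    module
  have := image_norm_le_of_norm_deriv_right_le_deriv_boundary (a := 0) (b := t)
    (B := fun r => ‖θ 0‖ + ρ * m / k * (Real.exp (k * r) - 1))
    (B' := fun r => Real.exp (k * r) * ρ * m)
    (fun r _ => (hder r).continuousAt.continuousWithinAt)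
    (fun r _ => (hder r).hasDerivWithinAt) (by simp)
    (fun r => by
      convert! (((hexp r).sub_const 1).const_mul (ρ * m / k)).const_add ‖θ 0‖ using 1
      field_simp)
    (fun r hr => by
      rw [norm_smul, norm_neg, Real.norm_of_nonneg (by positivity)]
      gcongr
      exact hm r ⟨hr.1, hr.2.le⟩) hs
  rw [norm_smul, Real.norm_of_nonneg (Real.exp_pos _).le] at this
  have hθ : ‖θ s‖ ≤ Real.exp (-(k * s)) * (‖θ 0‖ + ρ * m / k * (Real.exp (k * s) - 1)) := by
    have h2 := mul_le_mul_of_nonneg_left this (Real.exp_pos (-(k * s))).le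
    rwa [← mul_assoc, ← Real.exp_add, neg_add_cancel, Real.exp_zero, one_mul] at h2
  have e1 : Real.exp (-(k * s)) * (ρ * m / k * (Real.exp (k * s) - 1))
      = ρ * m / k * (1 - Real.exp (-(k * s))) := by
    have : Real.exp (-(k * s)) * Real.exp (k * s) = 1 := by
      rw [← Real.exp_add, neg_add_cancel, Real.exp_zero]
    linear_combination (ρ * m / k) * this
  have e2 : ρ * m / k * (1 - Real.exp (-(k * s))) ≤ ρ / σ * m := by
    have h5 : ρ * m / k ≤ ρ * m / σ := by
      gcongr
      simp only [k]; linarith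
    have h6 : 1 - Real.exp (-(k * s)) ≤ 1 := by linarith [Real.exp_pos (-(k * s))]
    calc ρ * m / k * (1 - Real.exp (-(k * s))) ≤ ρ * m / k * 1 := by gcongr
      _ ≤ ρ * m / σ := by linarith
      _ = _ := by ring
  have e3 : Real.exp (-(k * s)) ≤ Real.exp (-(σ * s)) := by
    apply Real.exp_le_exp.2
    have := hs.1
    simp only [k]; nlinarith
  have e4 : Real.exp (-(k * s)) * ‖θ 0‖ ≤ Real.exp (-(σ * s)) * ‖θ 0‖ := by gcongr
  rw [mul_add, e1] at hθ
  linarith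

/-- Up to the phase factor, the half-wave components `v ± iρu` barely move for short times. -/
theorem norm_half_wave_sub_le (h : IsPlateMode ρ σ u v θ) (hσ : 0 < σ) (hρ : 0 ≤ ρ) {t m : ℝ}
    (hm0 : 0 ≤ m) (hm : ∀ s ∈ Set.Icc 0 t, ‖v s‖ ≤ m) {ε : ℝ} (hε : ε ^ 2 = 1)
    {s : ℝ} (hs : s ∈ Set.Icc 0 t) :
    ‖(v s + (ε * ρ * Complex.I) * u s)
        - Complex.exp ((ε * ρ * Complex.I) * s) * (v 0 + (ε * ρ * Complex.I) * u 0)‖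
      ≤ ρ / σ * ‖θ 0‖ + ρ ^ 2 * t / σ * m := by
  set w : ℂ := ε * ρ * Complex.I with hw
  have hw2 : w * w = -(ρ : ℂ) ^ 2 := by
    have : (ε : ℂ) ^ 2 = 1 := by exact_mod_cast hε
    rw [hw]
    linear_combination (ρ : ℂ) ^ 2 * Complex.I ^ 2 * this + (ρ : ℂ) ^ 2 * Complex.I_sq
  have hnorm : ∀ r : ℝ, ‖Complex.exp (w * r)‖ = 1 := fun r => by
    rw [show w * (r : ℂ) = ((ε * ρ * r : ℝ) : ℂ) * Complex.I by rw [hw]; push_cast; ring]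
    exact Complex.norm_exp_ofReal_mul_I _
  have hexp : ∀ r : ℝ, HasDerivAt (fun r : ℝ => Complex.exp (-(w * r)))
      (Complex.exp (-(w * r)) * (-w)) r := fun r => by
    have h1 : HasDerivAt (fun r : ℝ => -(w * (r : ℂ))) (-w) r := by
      simpa using ((Complex.ofRealCLM.hasDerivAt (x := r)).const_mul w).fun_neg
    exact h1.cexp
  -- Since `w² = -ρ²`, the half-wave diagonalises the undamped plate equation and only the
  -- temperature perturbs it.
  have hz : ∀ r, HasDerivAt (fun r => v r + w * u r) (w * (v r + w * u r) + ρ * θ r) r := fun r => by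
    convert! (h.deriv_v r).add ((h.deriv_u r).const_mul w) using 1
    simp only [Complex.real_smul]
    push_cast
    linear_combination u r * hw2
  have hder : ∀ r : ℝ, HasDerivAt
      (fun r : ℝ => Complex.exp (-(w * r)) * (v r + w * u r) - (v 0 + w * u 0))
      (Complex.exp (-(w * r)) * (ρ * θ r)) r := fun r => by
    convert! ((hexp r).mul (hz r)).sub_const _ using 1
    ring
  have hnorm' : ∀ r : ℝ, ‖Complex.exp (-(w * r))‖ = 1 := fun r => by
    rw [Complex.exp_neg, norm_inv, hnorm, inv_one]
  have hE : ∀ r : ℝ, HasDerivAt (fun r : ℝ => Real.exp (-(σ * r))) (Real.exp (-(σ * r)) * (-σ)) r :=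
    fun r => by simpa using ((hasDerivAt_id r).const_mul σ).neg.exp
  have := image_norm_le_of_norm_deriv_right_le_deriv_boundary (a := 0) (b := t)
    (B := fun r => ρ / σ * ‖θ 0‖ * (1 - Real.exp (-(σ * r))) + ρ ^ 2 / σ * m * r)
    (B' := fun r => ρ * (Real.exp (-(σ * r)) * ‖θ 0‖ + ρ / σ * m))
    (fun r _ => (hder r).continuousAt.continuousWithinAt)
    (fun r _ => (hder r).hasDerivWithinAt) (by simp)
    (fun r => by
      convert! (((hE r).const_sub 1).const_mul (ρ / σ * ‖θ 0‖)).add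
        ((hasDerivAt_id r).const_mul (ρ ^ 2 / σ * m)) using 1
      field_simp)
    (fun r hr => by
      rw [norm_mul, hnorm', one_mul, norm_mul, Complex.norm_real, Real.norm_of_nonneg hρ]
      gcongr
      exact h.norm_θ_le hσ hρ hm0 hm ⟨hr.1, hr.2.le⟩) hs
  have e : (v s + w * u s) - Complex.exp (w * s) * (v 0 + w * u 0)
      = Complex.exp (w * s) * (Complex.exp (-(w * s)) * (v s + w * u s) - (v 0 + w * u 0)) := by
    have : Complex.exp (w * s) * Complex.exp (-(w * s)) = 1 := by
      rw [← Complex.exp_add, add_neg_cancel, Complex.exp_zero]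
    linear_combination (-(v s + w * u s)) * this
  rw [e, norm_mul, hnorm, one_mul]
  refine this.trans ?_
  have h1 : ρ / σ * ‖θ 0‖ * (1 - Real.exp (-(σ * s))) ≤ ρ / σ * ‖θ 0‖ * 1 := by
    gcongr
    linarith [Real.exp_pos (-(σ * s))]
  have h2 : ρ ^ 2 / σ * m * s ≤ ρ ^ 2 / σ * m * t := by
    gcongr
    exact hs.2
  calc _ ≤ ρ / σ * ‖θ 0‖ * 1 + ρ ^ 2 / σ * m * t := add_le_add h1 h2
    _ = _ := by ring

/-- Lower bound for the displacement of a Fourier mode in the oscillation zone `ρ²t ≲ σ`. -/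
theorem le_norm_u (h : IsPlateMode ρ σ u v θ) (hσ : 0 < σ) (hρ : 0 ≤ ρ) {t : ℝ} (ht : 0 ≤ t)
    (hρt : ρ ^ 2 * t ≤ σ / 16) :
    (|Real.sin (ρ * t)| - 1 / 8) * ‖v 0‖ - 2 * ρ * (‖u 0‖ + ‖θ 0‖ / σ) ≤ ρ * ‖u t‖ := by
  have hcont : ContinuousOn (fun s => ‖v s‖) (Set.Icc 0 t) :=
    fun r _ => (h.deriv_v r).continuousAt.norm.continuousWithinAt
  obtain ⟨s₀, hs₀, hmax⟩ := isCompact_Icc.exists_isMaxOn ⟨0, le_rfl, ht⟩ hcont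
  set m := ‖v s₀‖ with hmdef
  have hm0 : 0 ≤ m := norm_nonneg _
  have hm : ∀ s ∈ Set.Icc 0 t, ‖v s‖ ≤ m := fun s hs => hmax hs
  have hq : ρ ^ 2 * t / σ ≤ 1 / 16 := by
    rw [div_le_iff₀ hσ]; linarith
  set q := ρ ^ 2 * t / σ with hqdef
  have hq0 : 0 ≤ q := by positivity
  have hp := fun s hs => h.norm_half_wave_sub_le hσ hρ hm0 hm (ε := 1) (by norm_num) (s := s) hs
  have hn := fun s hs => h.norm_half_wave_sub_le hσ hρ hm0 hm (ε := -1) (by norm_num) (s := s) hs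
  simp only [Complex.ofReal_one, one_mul, Complex.ofReal_neg, neg_mul] at hp hn
  have hnorm : ∀ r : ℝ, ‖Complex.exp (ρ * Complex.I * r)‖ = 1 := fun r => by
    rw [show (ρ : ℂ) * Complex.I * (r : ℂ) = ((ρ * r : ℝ) : ℂ) * Complex.I by push_cast; ring]
    exact Complex.norm_exp_ofReal_mul_I _
  have hnorm' : ∀ r : ℝ, ‖Complex.exp (-(ρ * Complex.I * r))‖ = 1 := fun r => by
    rw [Complex.exp_neg, norm_inv, hnorm, inv_one]
  set e := ρ / σ * ‖θ 0‖ + q * m with he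
  have hwu : ‖(ρ * Complex.I) * u 0‖ = ρ * ‖u 0‖ := by
    rw [norm_mul, norm_mul, Complex.norm_I, mul_one, Complex.norm_real, Real.norm_of_nonneg hρ]
  -- The velocity is the mean of the two half-waves. The bound has `m` on both sides through `e`,
  -- but with factor `q ≤ 1/16` on the right, so it closes.
  have hmle : m ≤ ‖v 0‖ + ρ * ‖u 0‖ + e := by
    have h1 := hp s₀ hs₀
    have h2 := hn s₀ hs₀
    have a1 : ‖v s₀ + ρ * Complex.I * u s₀‖ ≤ ‖v 0‖ + ρ * ‖u 0‖ + e := by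
      calc ‖v s₀ + ρ * Complex.I * u s₀‖ = ‖(v s₀ + ρ * Complex.I * u s₀
          - Complex.exp (ρ * Complex.I * s₀) * (v 0 + ρ * Complex.I * u 0))
          + Complex.exp (ρ * Complex.I * s₀) * (v 0 + ρ * Complex.I * u 0)‖ := by ring_nf
        _ ≤ e + 1 * (‖v 0‖ + ρ * ‖u 0‖) := by
          refine (norm_add_le _ _).trans (add_le_add h1 ?_)
          rw [norm_mul, hnorm, ← hwu]
          gcongr
          exact norm_add_le _ _
        _ = _ := by ring
    have a2 : ‖v s₀ + -(ρ * Complex.I * u s₀)‖ ≤ ‖v 0‖ + ρ * ‖u 0‖ + e := by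
      calc ‖v s₀ + -(ρ * Complex.I * u s₀)‖ = ‖(v s₀ + -(ρ * Complex.I * u s₀)
          - Complex.exp (-(ρ * Complex.I * s₀)) * (v 0 + -(ρ * Complex.I * u 0)))
          + Complex.exp (-(ρ * Complex.I * s₀)) * (v 0 + -(ρ * Complex.I * u 0))‖ := by ring_nf
        _ ≤ e + 1 * (‖v 0‖ + ρ * ‖u 0‖) := by
          refine (norm_add_le _ _).trans (add_le_add h2 ?_)
          rw [norm_mul, hnorm', ← hwu, ← norm_neg (ρ * Complex.I * u 0)]
          gcongr
          exact norm_add_le _ _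
        _ = _ := by ring
    have a3 : m ≤ (‖v s₀ + ρ * Complex.I * u s₀‖ + ‖v s₀ + -(ρ * Complex.I * u s₀)‖) / 2 := by
      have : v s₀ = (1 / 2 : ℂ) * ((v s₀ + ρ * Complex.I * u s₀) + (v s₀ + -(ρ * Complex.I * u s₀))) := by
        ring
      rw [hmdef]
      conv_lhs => rw [this]
      rw [norm_mul]
      have := norm_add_le (v s₀ + ρ * Complex.I * u s₀) (v s₀ + -(ρ * Complex.I * u s₀))
      norm_num at this ⊢
      linarith
    linarith
  have hv0 := norm_nonneg (v 0)
  have hu0 : 0 ≤ ρ * ‖u 0‖ := by positivity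
  have hθ0 : 0 ≤ ρ / σ * ‖θ 0‖ := by positivity
  have hm2 : m ≤ 16 / 15 * (‖v 0‖ + ρ * ‖u 0‖ + ρ / σ * ‖θ 0‖) := by
    have : q * m ≤ 1 / 16 * m := by gcongr
    linarith
  have hqm : q * m ≤ 1 / 15 * (‖v 0‖ + ρ * ‖u 0‖ + ρ / σ * ‖θ 0‖) := by
    have : q * m ≤ 1 / 16 * m := by gcongr
    linarith
  have h1 := hp t ⟨ht, le_rfl⟩
  have h2 := hn t ⟨ht, le_rfl⟩
  -- The difference of the half-waves isolates `u`, and the difference of their phases is the sine.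
  have key : 2 * (ρ * Complex.I * u t)
      = 2 * Complex.I * Complex.sin (ρ * t) * v 0
        + 2 * Complex.cos (ρ * t) * (ρ * Complex.I * u 0)
        + ((v t + ρ * Complex.I * u t)
          - Complex.exp (ρ * Complex.I * t) * (v 0 + ρ * Complex.I * u 0))
        - ((v t + -(ρ * Complex.I * u t))
          - Complex.exp (-(ρ * Complex.I * t)) * (v 0 + -(ρ * Complex.I * u 0))) := by
    have e1 : Complex.exp (ρ * Complex.I * t)
        = Complex.cos (ρ * t) + Complex.sin (ρ * t) * Complex.I := by
      rw [← Complex.exp_mul_I]; ring_nf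
    have e2 : Complex.exp (-(ρ * Complex.I * t))
        = Complex.cos (ρ * t) - Complex.sin (ρ * t) * Complex.I := by
      rw [show -(ρ * Complex.I * t) = (-(ρ * t : ℂ)) * Complex.I by ring, Complex.exp_mul_I,
        Complex.cos_neg, Complex.sin_neg]
      ring
    rw [e1, e2]
    ring
  set A := (v t + ρ * Complex.I * u t)
          - Complex.exp (ρ * Complex.I * t) * (v 0 + ρ * Complex.I * u 0)
  set B := (v t + -(ρ * Complex.I * u t))
          - Complex.exp (-(ρ * Complex.I * t)) * (v 0 + -(ρ * Complex.I * u 0))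
  have hsin : ‖2 * Complex.I * Complex.sin (ρ * t) * v 0‖ = 2 * |Real.sin (ρ * t)| * ‖v 0‖ := by
    rw [show (ρ : ℂ) * t = ((ρ * t : ℝ) : ℂ) by push_cast; rfl, ← Complex.ofReal_sin]
    simp only [norm_mul, Complex.norm_I, Complex.norm_real, Real.norm_eq_abs]
    norm_num
  have hcos : ‖2 * Complex.cos (ρ * t) * (ρ * Complex.I * u 0)‖ ≤ 2 * (ρ * ‖u 0‖) := by
    rw [norm_mul, hwu, show (ρ : ℂ) * t = ((ρ * t : ℝ) : ℂ) by push_cast; rfl, ← Complex.ofReal_cos,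
      norm_mul, Complex.norm_real, Real.norm_eq_abs]
    have := Real.abs_cos_le_one (ρ * t)
    norm_num
    nlinarith
  have hfin : 2 * |Real.sin (ρ * t)| * ‖v 0‖ ≤ 2 * (ρ * ‖u t‖) + 2 * (ρ * ‖u 0‖) + e + e := by
    have hu : ‖2 * (ρ * Complex.I * u t)‖ = 2 * (ρ * ‖u t‖) := by
      simp only [norm_mul, Complex.norm_I, Complex.norm_real, Real.norm_of_nonneg hρ]
      norm_num
    have key' : 2 * Complex.I * Complex.sin (ρ * t) * v 0 = 2 * (ρ * Complex.I * u t)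
        - 2 * Complex.cos (ρ * t) * (ρ * Complex.I * u 0) - A + B := by
      rw [key]; ring
    rw [← hsin, key']
    refine (norm_add_le _ _).trans (add_le_add ((norm_sub_le _ _).trans (add_le_add
      ((norm_sub_le _ _).trans (add_le_add hu.le hcos)) h1)) h2)
  have : 2 * ρ * (‖u 0‖ + ‖θ 0‖ / σ) = 2 * (ρ * ‖u 0‖) + 2 * (ρ / σ * ‖θ 0‖) := by ring
  rw [this]
  nlinarith

end Wave

end IsPlateMode

/-! ### The solution operator of the mode system -/

/-- The generator of the mode system `IsPlateMode ρ σ`. -/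
noncomputable def plateGen (σ ρ : ℝ) : (ℂ × ℂ × ℂ) →L[ℝ] (ℂ × ℂ × ℂ) :=
  let f₁ := ContinuousLinearMap.fst ℝ ℂ (ℂ × ℂ)
  let f₂ := (ContinuousLinearMap.fst ℝ ℂ ℂ).comp (ContinuousLinearMap.snd ℝ ℂ (ℂ × ℂ))
  let f₃ := (ContinuousLinearMap.snd ℝ ℂ ℂ).comp (ContinuousLinearMap.snd ℝ ℂ (ℂ × ℂ))
  f₂.prod ((0 : (ℂ × ℂ × ℂ) →L[ℝ] ℂ).prod (-(σ • f₃)))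
    + ρ • (0 : (ℂ × ℂ × ℂ) →L[ℝ] ℂ).prod (f₃.prod (-f₃ - f₂))
    + ρ ^ 2 • (0 : (ℂ × ℂ × ℂ) →L[ℝ] ℂ).prod ((-f₁).prod 0)

theorem plateGen_apply (σ ρ : ℝ) (y : ℂ × ℂ × ℂ) :
    plateGen σ ρ y = (y.2.1, -(ρ ^ 2 • y.1) + ρ • y.2.2, -((ρ + σ) • y.2.2) - ρ • y.2.1) := by
  simp only [plateGen, add_apply, ContinuousLinearMap.prod_apply,
    smul_apply, ContinuousLinearMap.comp_apply, ContinuousLinearMap.coe_fst',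
    ContinuousLinearMap.coe_snd', zero_apply, neg_apply,
    sub_apply]
  ext <;> simp <;> ring

/-- The solution operator of the mode system. -/
noncomputable def plateFlow (σ ρ t : ℝ) : (ℂ × ℂ × ℂ) →L[ℝ] (ℂ × ℂ × ℂ) :=
  NormedSpace.exp (t • plateGen σ ρ)

theorem plateFlow_zero (σ ρ : ℝ) (y : ℂ × ℂ × ℂ) : plateFlow σ ρ 0 y = y := by
  have h : (0 : ℝ) • plateGen σ ρ = 0 := zero_smul ℝ (plateGen σ ρ)
  rw [plateFlow, h, NormedSpace.exp_zero]
  rfl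

/-- The generator is written as a polynomial in `ρ` with constant coefficients, which makes its
continuity evident. Joint continuity lets the Fourier-side solution be differentiated under the
integral and bounded on compact sets. -/
theorem continuous_plateFlow (σ : ℝ) : Continuous fun p : ℝ × ℝ => plateFlow σ p.1 p.2 := by
  let : NormedAlgebra ℚ ((ℂ × ℂ × ℂ) →L[ℝ] (ℂ × ℂ × ℂ)) := NormedAlgebra.restrictScalars ℚ ℝ _
  refine NormedSpace.exp_continuous.comp (continuous_snd.smul ?_)
  unfold plateGen
  fun_prop

theorem hasDerivAt_plateFlow (σ ρ t : ℝ) (y : ℂ × ℂ × ℂ) :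
    HasDerivAt (fun s => plateFlow σ ρ s y) (plateGen σ ρ (plateFlow σ ρ t y)) t := by
  have h := (hasDerivAt_exp_smul_const' (𝕂 := ℝ) (plateGen σ ρ) t).clm_apply (hasDerivAt_const t y)
  simpa [plateFlow] using h

theorem isPlateMode_plateFlow (σ ρ : ℝ) (y : ℂ × ℂ × ℂ) :
    IsPlateMode ρ σ (fun t => (plateFlow σ ρ t y).1) (fun t => (plateFlow σ ρ t y).2.1)
      (fun t => (plateFlow σ ρ t y).2.2) where
  deriv_u t := by
    have h := (ContinuousLinearMap.fst ℝ ℂ (ℂ × ℂ)).hasFDerivAt.comp_hasDerivAt t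
      (hasDerivAt_plateFlow σ ρ t y)
    simpa [Function.comp_def, plateGen_apply] using h
  deriv_v t := by
    have h := ((ContinuousLinearMap.fst ℝ ℂ ℂ).comp
      (ContinuousLinearMap.snd ℝ ℂ (ℂ × ℂ))).hasFDerivAt.comp_hasDerivAt t
      (hasDerivAt_plateFlow σ ρ t y)
    simpa [Function.comp_def, plateGen_apply] using h
  deriv_θ t := by
    have h := ((ContinuousLinearMap.snd ℝ ℂ ℂ).comp
      (ContinuousLinearMap.snd ℝ ℂ (ℂ × ℂ))).hasFDerivAt.comp_hasDerivAt t
      (hasDerivAt_plateFlow σ ρ t y)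
    simpa [Function.comp_def, plateGen_apply] using h

attribute [irreducible] plateFlow

/-! ### Uniqueness for the weak mode system -/

theorem hasDerivAt_integral_mul_of_hasCompactSupport {E : Type*} [TopologicalSpace E]
    [T2Space E] [MeasurableSpace E] [BorelSpace E] [SecondCountableTopology E]
    {μ : Measure E} [IsFiniteMeasureOnCompacts μ] {φ : E → ℂ} (hφ : Continuous φ)
    (hc : HasCompactSupport φ) {f f' : ℝ → E → ℂ} (hf : Continuous fun p : ℝ × E => f p.1 p.2)
    (hf' : Continuous fun p : ℝ × E => f' p.1 p.2)
    (hd : ∀ t x, HasDerivAt (fun s => f s x) (f' t x) t) (t : ℝ) :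
    HasDerivAt (fun s => ∫ x, φ x * f s x ∂μ) (∫ x, φ x * f' t x ∂μ) t := by
  have hK : IsCompact (Set.Icc (t - 1) (t + 1) ×ˢ tsupport φ) := isCompact_Icc.prod hc
  obtain ⟨B, hB⟩ := hK.exists_bound_of_continuousOn hf'.continuousOn
  have hfs : ∀ s, Continuous (f s) := fun s => hf.comp (by fun_prop : Continuous fun x => (s, x))
  have hfs' : ∀ s, Continuous (f' s) := fun s => hf'.comp (by fun_prop : Continuous fun x => (s, x))
  have hφi : Integrable φ μ := hφ.integrable_of_hasCompactSupport hc
  refine (hasDerivAt_integral_of_dominated_loc_of_deriv_le (F := fun s x => φ x * f s x)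
    (F' := fun s x => φ x * f' s x) (bound := fun x => ‖φ x‖ * B)
    (Metric.ball_mem_nhds t one_pos) (Eventually.of_forall fun s =>
      (hφ.mul (hfs s)).aestronglyMeasurable)
    ((hφ.mul (hfs t)).integrable_of_hasCompactSupport hc.mul_right)
    (hφ.mul (hfs' t)).aestronglyMeasurable ?_ (hφi.norm.mul_const B) ?_).2
  · refine Eventually.of_forall fun x s hs => ?_
    rw [norm_mul]
    by_cases hx : x ∈ tsupport φ
    · gcongr
      rw [Metric.mem_ball, Real.dist_eq, abs_lt] at hs
      exact hB (s, x) ⟨⟨by linarith [hs.1], by linarith [hs.2]⟩, hx⟩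
    · simp [image_eq_zero_of_notMem_tsupport hx]
  · exact Eventually.of_forall fun x s _ => (hd s x).const_mul (φ x)

/-- In the norm weighted by `e^(-lt)`, integration from `0` gains a factor `1/l`; this turns the
uniqueness argument into a contraction. -/
theorem norm_le_of_norm_deriv_le_exp {f f' : ℝ → ℂ} {B l T : ℝ} (hl : 0 < l) (hB : 0 ≤ B)
    (h0 : f 0 = 0) (hf : ∀ t, 0 ≤ t → HasDerivWithinAt f (f' t) (Set.Ici 0) t)
    (hf' : ∀ t ∈ Set.Icc 0 T, ‖f' t‖ ≤ B * Real.exp (l * t)) :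
    ∀ t ∈ Set.Icc 0 T, ‖f t‖ ≤ B / l * Real.exp (l * t) := by
  intro t ht
  refine image_norm_le_of_norm_deriv_right_le_deriv_boundary (a := 0) (b := T)
    (B := fun r => B / l * Real.exp (l * r)) (B' := fun r => B * Real.exp (l * r))
    (fun r hr => ((hf r hr.1).continuousWithinAt).mono Set.Icc_subset_Ici_self)
    (fun r hr => (hf r hr.1).mono (Set.Ici_subset_Ici.2 hr.1)) ?_ (fun r => ?_)
    (fun r hr => hf' r ⟨hr.1, hr.2.le⟩) ht
  · rw [h0, norm_zero]; positivity
  · have : HasDerivAt (fun r => Real.exp (l * r)) (Real.exp (l * r) * l) r := by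
      simpa using ((hasDerivAt_id r).const_mul l).exp
    convert! this.const_mul (B / l) using 1
    field_simp

/-- Uniqueness for the weak form of the mode system, on a class of test objects on which the
multiplier `m` (multiplication by `ρ`) is bounded. -/
theorem weak_plate_unique {X : Type*} (m : X → X) (p : X → ℝ) {R σ : ℝ} (hR : 0 ≤ R) (hσ : 0 ≤ σ)
    (hp : ∀ x, 0 ≤ p x) (hm : ∀ x, p (m x) ≤ R * p x) (G V Θ : X → ℝ → ℂ)
    (hG : ∀ x t, 0 ≤ t → HasDerivWithinAt (G x) (V x t) (Set.Ici 0) t)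
    (hV : ∀ x t, 0 ≤ t →
      HasDerivWithinAt (V x) (-G (m (m x)) t + Θ (m x) t) (Set.Ici 0) t)
    (hΘ : ∀ x t, 0 ≤ t →
      HasDerivWithinAt (Θ x) (-Θ (m x) t - σ * Θ x t - V (m x) t) (Set.Ici 0) t)
    (hG0 : ∀ x, G x 0 = 0) (hV0 : ∀ x, V x 0 = 0) (hΘ0 : ∀ x, Θ x 0 = 0)
    (hbdd : ∀ T, 0 ≤ T → ∃ K, ∀ x, ∀ s ∈ Set.Icc 0 T, ‖G x s‖ ≤ K * p x) (x : X) {T : ℝ}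
    (hT : 0 ≤ T) : G x T = 0 := by
  set C := R ^ 3 + σ * R ^ 2 + 2 * R ^ 2 + R + σ with hC
  have hC0 : 0 ≤ C := by positivity
  -- Chosen so that `C/l ≤ 1/2`: each pass through the system then halves the bound on `G`.
  set l := 1 + 2 * C with hl
  have hl1 : 1 ≤ l := by linarith
  have hl0 : 0 < l := by linarith
  obtain ⟨K', hK'⟩ := hbdd T hT
  set K := max K' 0
  have hK0 : 0 ≤ K := le_max_right _ _
  have hm2 : ∀ x, p (m (m x)) ≤ R ^ 2 * p x := fun x => by
    calc p (m (m x)) ≤ R * p (m x) := hm _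
      _ ≤ R * (R * p x) := by gcongr; exact hm x
      _ = _ := by ring
  have hm3 : ∀ x, p (m (m (m x))) ≤ R ^ 3 * p x := fun x => by
    calc p (m (m (m x))) ≤ R * p (m (m x)) := hm _
      _ ≤ R * (R ^ 2 * p x) := by gcongr; exact hm2 x
      _ = _ := by ring
  have step : ∀ k : ℕ, ∀ x, ∀ s ∈ Set.Icc 0 T,
      ‖G x s‖ ≤ K * (1 / 2) ^ k * p x * Real.exp (l * s) := by
    intro k
    induction k with
    | zero =>
      intro x s hs
      have h1 : 1 ≤ Real.exp (l * s) := Real.one_le_exp (mul_nonneg hl0.le hs.1)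
      calc ‖G x s‖ ≤ K' * p x := hK' x s hs
        _ ≤ K * p x := by gcongr; exacts [hp x, le_max_left _ _]
        _ = K * p x * 1 := by ring
        _ ≤ K * p x * Real.exp (l * s) := by gcongr; exact mul_nonneg hK0 (hp x)
        _ = _ := by ring
    | succ k ih =>
      intro x
      set N := K * (1 / 2) ^ k * p x with hN
      have hKk : 0 ≤ K * (1 / 2) ^ k := by positivity
      have hN0 : 0 ≤ N := mul_nonneg hKk (hp x)
      have bnd : ∀ y c, p y ≤ c * p x → ∀ s ∈ Set.Icc 0 T, ‖G y s‖ ≤ c * N * Real.exp (l * s) := by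
        intro y c hy s hs
        calc ‖G y s‖ ≤ K * (1 / 2) ^ k * p y * Real.exp (l * s) := ih y s hs
          _ ≤ K * (1 / 2) ^ k * (c * p x) * Real.exp (l * s) := by gcongr
          _ = _ := by rw [hN]; ring
      have b1 := bnd _ _ (hm x)
      have b2 := bnd _ _ (hm2 x)
      have b3 := bnd _ _ (hm3 x)
      -- Only `G` has an a priori bound, so `V` and `Θ` must never be estimated. `Q` and `S` are
      -- arranged so that `Q'` involves `G` alone, `S'` involves `Q` and `G`, and `G'` involves `S`
      -- and `G`: the third-order equation for `G`, integrated three times.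
      set Q : ℝ → ℂ := fun s => Θ (m x) s + V (m x) s + σ * V x s + G (m (m x)) s with hQ
      set S : ℝ → ℂ := fun s => V x s + G (m x) s + σ * G x s with hS
      have dQ : ∀ s, 0 ≤ s → HasDerivWithinAt Q
          (-G (m (m (m x))) s - σ * G (m (m x)) s) (Set.Ici 0) s := fun s hs => by
        convert! (((hΘ (m x) s hs).add (hV (m x) s hs)).add ((hV x s hs).const_mul (σ : ℂ))).add
          (hG (m (m x)) s hs) using 1
        ring
      have dS : ∀ s, 0 ≤ s → HasDerivWithinAt S (Q s - 2 * G (m (m x)) s) (Set.Ici 0) s :=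
          fun s hs => by
        convert! ((hV x s hs).add (hG (m x) s hs)).add ((hG x s hs).const_mul (σ : ℂ)) using 1
        simp only [hQ]
        ring
      have dG : ∀ s, 0 ≤ s → HasDerivWithinAt (G x) (S s - G (m x) s - σ * G x s) (Set.Ici 0) s :=
          fun s hs => by
        convert! hG x s hs using 1
        simp only [hS]
        ring
      have bQ := norm_le_of_norm_deriv_le_exp (T := T) (B := (R ^ 3 + σ * R ^ 2) * N) hl0
        (by positivity) (by simp [hQ, hΘ0, hV0, hG0]) dQ (fun s hs => by
          refine (norm_sub_le _ _).trans ?_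
          rw [norm_neg, norm_mul, Complex.norm_real, Real.norm_of_nonneg hσ]
          calc _ ≤ R ^ 3 * N * Real.exp (l * s) + σ * (R ^ 2 * N * Real.exp (l * s)) := by
                gcongr
                exacts [b3 s hs, b2 s hs]
            _ = _ := by ring)
      have bS := norm_le_of_norm_deriv_le_exp (T := T)
        (B := (R ^ 3 + σ * R ^ 2 + 2 * R ^ 2) * N) hl0
        (by positivity) (by simp [hS, hV0, hG0]) dS (fun s hs => by
          refine (norm_sub_le _ _).trans ?_
          rw [norm_mul, Complex.norm_ofNat]
          have h1 : (R ^ 3 + σ * R ^ 2) * N / l ≤ (R ^ 3 + σ * R ^ 2) * N :=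
            div_le_self (by positivity) hl1
          calc _ ≤ (R ^ 3 + σ * R ^ 2) * N * Real.exp (l * s)
                + 2 * (R ^ 2 * N * Real.exp (l * s)) := by
                gcongr
                · exact (bQ s hs).trans (by gcongr)
                · exact b2 s hs
            _ = _ := by ring)
      have bG := norm_le_of_norm_deriv_le_exp (T := T) (B := C * N) hl0
        (by positivity) (hG0 x) dG (fun s hs => by
          refine (norm_sub_le _ _).trans ?_
          rw [norm_mul, Complex.norm_real, Real.norm_of_nonneg hσ]
          have h1 : (R ^ 3 + σ * R ^ 2 + 2 * R ^ 2) * N / l ≤ (R ^ 3 + σ * R ^ 2 + 2 * R ^ 2) * N :=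
            div_le_self (by positivity) hl1
          calc _ ≤ ((R ^ 3 + σ * R ^ 2 + 2 * R ^ 2) * N * Real.exp (l * s)
                + R * N * Real.exp (l * s)) + σ * (N * Real.exp (l * s)) := by
                gcongr
                · refine (norm_sub_le _ _).trans (add_le_add ?_ (b1 s hs))
                  exact (bS s hs).trans (by gcongr)
                · exact ih x s hs
            _ = _ := by rw [hC]; ring)
      intro s hs
      refine (bG s hs).trans ?_
      gcongr
      have : C * N / l ≤ N / 2 := by
        rw [div_le_div_iff₀ hl0 two_pos, hl]
        nlinarith
      calc C * N / l ≤ N / 2 := this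
        _ = _ := by rw [hN, pow_succ]; ring
  have hlim : Tendsto (fun k : ℕ => K * (1 / 2) ^ k * p x * Real.exp (l * T)) atTop
      (nhds (K * 0 * p x * Real.exp (l * T))) :=
    (((tendsto_pow_atTop_nhds_zero_of_lt_one (by norm_num) (by norm_num)).const_mul K).mul_const
      _).mul_const _
  have := ge_of_tendsto' hlim fun k => step k x T ⟨hT, le_rfl⟩
  simpa using this

/-! ### Fourier transform of tempered distributions, `L²` and `L¹` functions -/

section Bridge

variable {n : ℕ}

/-- The symbol `|2πξ|²` of `-Δ`. -/
noncomputable def freqSq (ξ : EuclideanSpace ℝ (Fin n)) : ℝ := (2 * Real.pi) ^ 2 * ‖ξ‖ ^ 2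

theorem freqSq_nonneg (ξ : EuclideanSpace ℝ (Fin n)) : 0 ≤ freqSq ξ := by
  unfold freqSq; positivity

theorem continuous_freqSq : Continuous (freqSq (n := n)) := by
  unfold freqSq; fun_prop

theorem hasTemperateGrowth_norm_sq_ofReal :
    Function.HasTemperateGrowth (fun ξ : EuclideanSpace ℝ (Fin n) => ((‖ξ‖ ^ 2 : ℝ) : ℂ)) := by
  fun_prop

/-- Multiplication of a Schwartz function by `|2πξ|²`. -/
noncomputable def freqMul (φ : 𝓢(EuclideanSpace ℝ (Fin n), ℂ)) :
    𝓢(EuclideanSpace ℝ (Fin n), ℂ) :=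
  (((2 * Real.pi) ^ 2 : ℝ) : ℂ) •
    SchwartzMap.smulLeftCLM ℂ (fun ξ : EuclideanSpace ℝ (Fin n) => ((‖ξ‖ ^ 2 : ℝ) : ℂ)) φ

theorem freqMul_apply (φ : 𝓢(EuclideanSpace ℝ (Fin n), ℂ)) (ξ : EuclideanSpace ℝ (Fin n)) :
    freqMul φ ξ = freqSq ξ * φ ξ := by
  simp only [freqMul, freqSq, smul_apply,
    SchwartzMap.smulLeftCLM_apply_apply hasTemperateGrowth_norm_sq_ofReal, smul_eq_mul]
  push_cast
  ring

/-- Testing against `𝓕 φ` instead of `φ` reads the equations on the Fourier side, where the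
Laplacian is moved onto the test function as a multiplication. -/
theorem laplacian_apply_fourier (T : 𝓢'(EuclideanSpace ℝ (Fin n), ℂ))
    (φ : 𝓢(EuclideanSpace ℝ (Fin n), ℂ)) : (Δ T) (𝓕 φ) = -T (𝓕 (freqMul φ)) := by
  have e : 𝓕 (freqMul φ) = (((2 * Real.pi) ^ 2 : ℝ) : ℂ) •
      𝓕 (SchwartzMap.smulLeftCLM ℂ (fun ξ : EuclideanSpace ℝ (Fin n) => ((‖ξ‖ ^ 2 : ℝ) : ℂ)) φ) :=
    FourierTransform.fourier_smul _ _
  rw [TemperedDistribution.laplacian_eq_fourierMultiplierCLM, e]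
  have e2 : ∀ (c : ℝ) (S : 𝓢'(EuclideanSpace ℝ (Fin n), ℂ)) (ψ), (c • S) ψ = c • S ψ :=
    fun _ _ _ => rfl
  rw [e2, TemperedDistribution.fourierMultiplierCLM_apply_apply,
    FourierTransform.fourierInv_fourier_eq, map_smul, smul_eq_mul, Complex.real_smul]
  push_cast
  ring

theorem continuous_fourier_of_integrable {f : EuclideanSpace ℝ (Fin n) → ℂ} (hf : Integrable f) :
    Continuous (𝓕 f) :=
  VectorFourier.fourierIntegral_continuous Real.continuous_fourierChar
    (innerSL ℝ).continuous₂ hf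

theorem norm_fourier_le_integral_norm (f : EuclideanSpace ℝ (Fin n) → ℂ)
    (ξ : EuclideanSpace ℝ (Fin n)) : ‖𝓕 f ξ‖ ≤ ∫ x, ‖f x‖ :=
  VectorFourier.norm_fourierIntegral_le_integral_norm _ _ _ _ _

theorem integral_fourier_mul_of_integrable {f : EuclideanSpace ℝ (Fin n) → ℂ} (hf : Integrable f)
    (φ : 𝓢(EuclideanSpace ℝ (Fin n), ℂ)) : ∫ x, 𝓕 φ x * f x = ∫ ξ, φ ξ * 𝓕 f ξ := by
  simpa using! VectorFourier.integral_bilin_fourierIntegral_eq_flip (ContinuousLinearMap.mul ℂ ℂ)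
    (L := innerₗ (EuclideanSpace ℝ (Fin n)))
    Real.continuous_fourierChar continuous_inner φ.integrable hf

theorem toTemperedDistribution_fourier_apply
    (f : Lp ℂ 2 (volume : Measure (EuclideanSpace ℝ (Fin n))))
    (φ : 𝓢(EuclideanSpace ℝ (Fin n), ℂ)) :
    Lp.toTemperedDistribution f (𝓕 φ) = ∫ ξ, φ ξ * (𝓕 f : Lp ℂ 2 _) ξ := by
  have h := DFunLike.congr_fun (Lp.fourier_toTemperedDistribution_eq f) φ
  rw [TemperedDistribution.fourier_apply, Lp.toTemperedDistribution_apply] at h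
  simpa using h

theorem toTemperedDistribution_fourier_apply_of_integrable
    {f : Lp ℂ 2 (volume : Measure (EuclideanSpace ℝ (Fin n)))} (hf : Integrable f)
    (φ : 𝓢(EuclideanSpace ℝ (Fin n), ℂ)) :
    Lp.toTemperedDistribution f (𝓕 φ) = ∫ ξ, φ ξ * 𝓕 (f : EuclideanSpace ℝ (Fin n) → ℂ) ξ := by
  rw [Lp.toTemperedDistribution_apply, ← integral_fourier_mul_of_integrable hf]
  simp

/-- Locally integrable functions agreeing against all compactly supported Schwartz functions agree
almost everywhere. -/
theorem ae_eq_of_forall_schwartz {f g : EuclideanSpace ℝ (Fin n) → ℂ}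
    (hf : LocallyIntegrable f) (hg : LocallyIntegrable g)
    (h : ∀ φ : 𝓢(EuclideanSpace ℝ (Fin n), ℂ), ∀ R : ℝ, (∀ ξ, R < ‖ξ‖ → φ ξ = 0) →
      ∫ ξ, φ ξ * f ξ = ∫ ξ, φ ξ * g ξ) : f =ᵐ[volume] g := by
  refine ae_eq_of_integral_contDiff_smul_eq hf hg fun k hk hkc => ?_
  have hc : HasCompactSupport (Complex.ofRealCLM ∘ k) := hkc.comp_left rfl
  have hs : ContDiff ℝ (↑(⊤ : ℕ∞)) (Complex.ofRealCLM ∘ k) := by fun_prop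
  obtain ⟨R, hR⟩ := hkc.isBounded.exists_norm_le
  have := h (hc.toSchwartzMap hs) R fun ξ hξ => by
    have : k ξ = 0 := by
      by_contra hne
      exact absurd (hR ξ (subset_tsupport _ hne)) (not_le.2 hξ)
    simp [this]
  simpa using this

/-- Links the two Fourier transforms in play: the one on `L²` carries Plancherel, the integral one
carries continuity and pointwise bounds. Both represent the same distribution. -/
theorem fourier_ae_eq {f : Lp ℂ 2 (volume : Measure (EuclideanSpace ℝ (Fin n)))}
    (hf : Integrable f) :
    ((𝓕 f : Lp ℂ 2 _) : EuclideanSpace ℝ (Fin n) → ℂ) =ᵐ[volume]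
      𝓕 (f : EuclideanSpace ℝ (Fin n) → ℂ) :=
  ae_eq_of_forall_schwartz ((Lp.memLp _).locallyIntegrable one_le_two)
    (continuous_fourier_of_integrable hf).locallyIntegrable fun φ _ _ => by
      rw [← toTemperedDistribution_fourier_apply,
        toTemperedDistribution_fourier_apply_of_integrable hf]

theorem lp_two_norm_sq_eq_integral {α : Type*} [MeasurableSpace α] {μ : Measure α}
    (f : Lp ℂ 2 μ) : ‖f‖ ^ 2 = ∫ x, ‖f x‖ ^ 2 ∂μ := by
  rw [← @inner_self_eq_norm_sq ℂ (Lp ℂ 2 μ) _ _ _ f, L2.inner_def,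
    ← integral_re (L2.integrable_inner f f)]
  congr 1
  ext x
  exact inner_self_eq_norm_sq (𝕜 := ℂ) (f x)

/-- Uses `x ≤ 1 + x²` in place of Cauchy–Schwarz; only a locally uniform bound is needed later, not
a sharp one. -/
theorem integral_norm_le_measure_add_norm_sq {α : Type*} [MeasurableSpace α] {μ : Measure α}
    (f : Lp ℂ 2 μ) {s : Set α} (hs : μ s ≠ ⊤) :
    ∫ x in s, ‖f x‖ ∂μ ≤ μ.real s + ‖f‖ ^ 2 := by
  have h2 : Integrable (fun x => ‖f x‖ ^ 2) μ := (Lp.memLp f).integrable_norm_pow two_ne_zero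
  have : IsFiniteMeasure (μ.restrict s) := ⟨by simpa using hs.lt_top⟩
  calc ∫ x in s, ‖f x‖ ∂μ ≤ ∫ x in s, (1 + ‖f x‖ ^ 2) ∂μ := by
        apply integral_mono_of_nonneg (Eventually.of_forall fun _ => norm_nonneg _)
          ((integrable_const _).add h2.integrableOn)
        exact Eventually.of_forall fun x => by
          have : ‖f x‖ ≤ 1 + ‖f x‖ ^ 2 := by nlinarith [sq_nonneg (‖f x‖ - 1)]
          exact this
    _ = μ.real s + ∫ x in s, ‖f x‖ ^ 2 ∂μ := by
        rw [integral_add (integrable_const _) h2.integrableOn]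
        simp
    _ ≤ _ := by
        rw [lp_two_norm_sq_eq_integral f]
        refine add_le_add le_rfl ?_
        exact setIntegral_le_integral h2 (Eventually.of_forall fun x => by positivity)

end Bridge

/-! ### Every solution is given by the mode system -/

section Representation

variable {n : ℕ}

theorem HasTimeDeriv.apply {f f' : ℝ → 𝓢'(EuclideanSpace ℝ (Fin n), ℂ)} (h : HasTimeDeriv f f')
    (φ : 𝓢(EuclideanSpace ℝ (Fin n), ℂ)) {t : ℝ} (ht : 0 ≤ t) :
    HasDerivWithinAt (fun s => f s φ) (f' t φ) (Set.Ici 0) t := h φ t ht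

theorem hasCompactSupport_of_forall_norm_gt {φ : EuclideanSpace ℝ (Fin n) → ℂ} {R : ℝ}
    (h : ∀ ξ, R < ‖ξ‖ → φ ξ = 0) : HasCompactSupport φ :=
  HasCompactSupport.intro (isCompact_closedBall 0 R) fun ξ hξ => h ξ (by simpa using hξ)

theorem norm_integral_mul_le_of_forall_norm_gt {φ f : EuclideanSpace ℝ (Fin n) → ℂ} {R M : ℝ}
    (h : ∀ ξ, R < ‖ξ‖ → φ ξ = 0) (hM : ∀ ξ, ‖φ ξ‖ ≤ M)
    (hf : IntegrableOn f (Metric.closedBall 0 R)) :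
    ‖∫ ξ, φ ξ * f ξ‖ ≤ M * ∫ ξ in Metric.closedBall 0 R, ‖f ξ‖ := by
  have e : ∫ ξ, φ ξ * f ξ = ∫ ξ in Metric.closedBall 0 R, φ ξ * f ξ := by
    refine (setIntegral_eq_integral_of_forall_compl_eq_zero fun ξ hξ => ?_).symm
    rw [h ξ (by simpa using hξ), zero_mul]
  rw [e, ← integral_const_mul]
  refine norm_integral_le_of_norm_le (hf.norm.const_mul M) (Eventually.of_forall fun ξ => ?_)
  rw [norm_mul]
  gcongr
  exact hM ξ

/-- The solution of the plate system in Fourier variables. -/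
noncomputable def plateSymbol (σ : ℝ) (y₀ : EuclideanSpace ℝ (Fin n) → ℂ × ℂ × ℂ) (t : ℝ)
    (ξ : EuclideanSpace ℝ (Fin n)) : ℂ × ℂ × ℂ :=
  plateFlow σ (freqSq ξ) t (y₀ ξ)

theorem continuous_plateSymbol (σ : ℝ) {y₀ : EuclideanSpace ℝ (Fin n) → ℂ × ℂ × ℂ}
    (hy : Continuous y₀) :
    Continuous fun p : ℝ × EuclideanSpace ℝ (Fin n) => plateSymbol σ y₀ p.1 p.2 :=
  ((continuous_plateFlow σ).comp ((continuous_freqSq.comp continuous_snd).prodMk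
    continuous_fst)).clm_apply (hy.comp continuous_snd)

theorem continuous_plateSymbol_apply (σ : ℝ) {y₀ : EuclideanSpace ℝ (Fin n) → ℂ × ℂ × ℂ}
    (hy : Continuous y₀) (t : ℝ) : Continuous (plateSymbol σ y₀ t) := by
  have h := (continuous_plateSymbol σ hy).comp (Continuous.prodMk_right t)
  exact h

theorem isPlateMode_plateSymbol (σ : ℝ) (y₀ : EuclideanSpace ℝ (Fin n) → ℂ × ℂ × ℂ)
    (ξ : EuclideanSpace ℝ (Fin n)) :
    IsPlateMode (freqSq ξ) σ (fun t => (plateSymbol σ y₀ t ξ).1)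
      (fun t => (plateSymbol σ y₀ t ξ).2.1) (fun t => (plateSymbol σ y₀ t ξ).2.2) :=
  isPlateMode_plateFlow σ (freqSq ξ) (y₀ ξ)

theorem plateSymbol_zero (σ : ℝ) (y₀ : EuclideanSpace ℝ (Fin n) → ℂ × ℂ × ℂ)
    (ξ : EuclideanSpace ℝ (Fin n)) : plateSymbol σ y₀ 0 ξ = y₀ ξ :=
  plateFlow_zero _ _ _

variable {σ : ℝ} {u₀ u₁ θ₀ : Lp ℂ 2 (volume : Measure (EuclideanSpace ℝ (Fin n)))}
  {u : ℝ → Lp ℂ 2 (volume : Measure (EuclideanSpace ℝ (Fin n)))}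
  {ut θ : ℝ → 𝓢'(EuclideanSpace ℝ (Fin n), ℂ)}

/-- The Fourier transforms of the initial data. -/
noncomputable def fourierData (u₀ u₁ θ₀ : EuclideanSpace ℝ (Fin n) → ℂ)
    (ξ : EuclideanSpace ℝ (Fin n)) : ℂ × ℂ × ℂ :=
  (𝓕 u₀ ξ, 𝓕 u₁ ξ, 𝓕 θ₀ ξ)

theorem continuous_fourierData {f g h : EuclideanSpace ℝ (Fin n) → ℂ} (hf : Integrable f)
    (hg : Integrable g) (hh : Integrable h) : Continuous (fourierData f g h) :=
  (continuous_fourier_of_integrable hf).prodMk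
    ((continuous_fourier_of_integrable hg).prodMk (continuous_fourier_of_integrable hh))

/-- The Fourier transform of the displacement is given by the mode system with data `y₀`, if `y₀`
represents the Fourier transforms of the initial data. -/
theorem IsThermoelasticPlateSolution.fourier_ae_eq_of_data
    (hsol : IsThermoelasticPlateSolution σ u₀ u₁ θ₀ u ut θ) (hσ : 0 ≤ σ)
    {y₀ : EuclideanSpace ℝ (Fin n) → ℂ × ℂ × ℂ} (hy : Continuous y₀)
    (hu₀ : ∀ φ : 𝓢(EuclideanSpace ℝ (Fin n), ℂ), Lp.toTemperedDistribution u₀ (𝓕 φ) = ∫ ξ, φ ξ * (y₀ ξ).1)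
    (hu₁ : ∀ φ : 𝓢(EuclideanSpace ℝ (Fin n), ℂ), Lp.toTemperedDistribution u₁ (𝓕 φ) = ∫ ξ, φ ξ * (y₀ ξ).2.1)
    (hθ₀ : ∀ φ : 𝓢(EuclideanSpace ℝ (Fin n), ℂ), Lp.toTemperedDistribution θ₀ (𝓕 φ) = ∫ ξ, φ ξ * (y₀ ξ).2.2)
    {T : ℝ} (hT : 0 ≤ T) :
    ((𝓕 (u T) : Lp ℂ 2 _) : EuclideanSpace ℝ (Fin n) → ℂ) =ᵐ[volume]
      fun ξ => (plateSymbol σ y₀ T ξ).1 := by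
  have hY := continuous_plateSymbol σ hy
  have hYt : ∀ t, Continuous (plateSymbol σ y₀ t) := fun t =>
    continuous_plateSymbol_apply σ hy t
  refine ae_eq_of_forall_schwartz ((Lp.memLp _).locallyIntegrable one_le_two)
    (hYt T).fst.locallyIntegrable fun ψ R' hψ => ?_
  obtain ⟨R, hR0, hR⟩ : ∃ R : ℝ, 0 ≤ R ∧ ∀ ξ, R < ‖ξ‖ → ψ ξ = 0 :=
    ⟨max R' 0, le_max_right _ _, fun ξ hξ => hψ ξ ((le_max_left _ _).trans_lt hξ)⟩
  -- Support in a fixed ball makes multiplication by `freqSq` bounded in the sup norm `p`, as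
  -- `weak_plate_unique` requires, and is preserved by it.
  let X := {φ : 𝓢(EuclideanSpace ℝ (Fin n), ℂ) // ∀ ξ, R < ‖ξ‖ → φ ξ = 0}
  let m : X → X := fun φ => ⟨freqMul φ.1, fun ξ hξ => by rw [freqMul_apply, φ.2 ξ hξ, mul_zero]⟩
  let p : X → ℝ := fun φ => ‖φ.1.toBoundedContinuousFunction‖
  have hp : ∀ φ : X, ∀ ξ, ‖φ.1 ξ‖ ≤ p φ := fun φ ξ =>
    φ.1.toBoundedContinuousFunction.norm_coe_le_norm ξ
  have hc : ∀ φ : X, HasCompactSupport φ.1 := fun φ => hasCompactSupport_of_forall_norm_gt φ.2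
  have hint : ∀ φ : X, ∀ f : EuclideanSpace ℝ (Fin n) → ℂ, Continuous f →
      Integrable fun ξ => φ.1 ξ * f ξ := fun φ f hf =>
    (φ.1.continuous.mul hf).integrable_of_hasCompactSupport (hc φ).mul_right
  let G : X → ℝ → ℂ := fun φ t =>
    Lp.toTemperedDistribution (u t) (𝓕 φ.1) - ∫ ξ, φ.1 ξ * (plateSymbol σ y₀ t ξ).1
  let V : X → ℝ → ℂ := fun φ t => ut t (𝓕 φ.1) - ∫ ξ, φ.1 ξ * (plateSymbol σ y₀ t ξ).2.1
  let Θ : X → ℝ → ℂ := fun φ t => θ t (𝓕 φ.1) - ∫ ξ, φ.1 ξ * (plateSymbol σ y₀ t ξ).2.2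
  obtain ⟨utt, hutt, hplate⟩ := hsol.plate
  obtain ⟨θt, hθt, hheat⟩ := hsol.heat
  have key : G ⟨ψ, hR⟩ T = 0 := by
    refine weak_plate_unique m p (R := (2 * Real.pi) ^ 2 * R ^ 2) (σ := σ) (by positivity) hσ
      (fun φ => norm_nonneg _) (fun φ => ?_) G V Θ (fun φ t ht => ?_) (fun φ t ht => ?_)
      (fun φ t ht => ?_) (fun φ => ?_) (fun φ => ?_) (fun φ => ?_) (fun T' hT' => ?_) _ hT
    · refine (BoundedContinuousFunction.norm_le (by positivity)).2 fun ξ => ?_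
      rw [SchwartzMap.toBoundedContinuousFunction_apply]
      simp only [m]
      by_cases hξ : R < ‖ξ‖
      · rw [freqMul_apply, φ.2 ξ hξ, mul_zero, norm_zero]
        positivity
      · rw [freqMul_apply, norm_mul, Complex.norm_real, Real.norm_of_nonneg (freqSq_nonneg ξ),
          freqSq]
        push Not at hξ
        gcongr
        exact hp φ ξ
    · exact (hsol.velocity.apply _ ht).sub (hasDerivAt_integral_mul_of_hasCompactSupport
        φ.1.continuous (hc φ) hY.fst hY.snd.fst
        (fun t ξ => (isPlateMode_plateSymbol σ y₀ ξ).deriv_u t) t).hasDerivWithinAt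
    · have h1 := hutt.apply (𝓕 φ.1) ht
      have h2 := (hasDerivAt_integral_mul_of_hasCompactSupport (μ := volume)
        φ.1.continuous (hc φ) hY.snd.fst (f' := fun t ξ => _) (by
          have := continuous_freqSq (n := n)
          have h1 := hY.fst
          have h2 := hY.snd.snd
          fun_prop)
        (fun t ξ => (isPlateMode_plateSymbol σ y₀ ξ).deriv_v t) t).hasDerivWithinAt (s := Set.Ici 0)
      convert! h1.sub h2 using 1
      have e1 : utt t (𝓕 φ.1) = -Lp.toTemperedDistribution (u t) (𝓕 (freqMul (freqMul φ.1)))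
          + θ t (𝓕 (freqMul φ.1)) := by
        have := DFunLike.congr_fun (hplate t ht) (𝓕 φ.1)
        have e : utt t (𝓕 φ.1) + (Δ (Δ (Lp.toTemperedDistribution (u t)))) (𝓕 φ.1)
            + (Δ (θ t)) (𝓕 φ.1) = 0 := this
        rw [laplacian_apply_fourier, laplacian_apply_fourier, laplacian_apply_fourier] at e
        linear_combination e
      have e2 : ∫ ξ, φ.1 ξ * (-(freqSq ξ ^ 2 • (plateSymbol σ y₀ t ξ).1)
          + freqSq ξ • (plateSymbol σ y₀ t ξ).2.2) =
          -(∫ ξ, (m (m φ)).1 ξ * (plateSymbol σ y₀ t ξ).1)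
          + ∫ ξ, (m φ).1 ξ * (plateSymbol σ y₀ t ξ).2.2 := by
        have i1 : Integrable fun ξ => -((m (m φ)).1 ξ * (plateSymbol σ y₀ t ξ).1) :=
          (hint _ _ (hYt t).fst).neg
        rw [← integral_neg, ← integral_add i1 (hint (m φ) _ (hYt t).snd.snd)]
        congr 1
        ext ξ
        simp only [m, freqMul_apply, Complex.real_smul]
        push_cast
        ring
      rw [e1, e2]
      simp only [G, Θ, m]
      ring
    · have h1 := hθt.apply (𝓕 φ.1) ht
      have h2 := (hasDerivAt_integral_mul_of_hasCompactSupport (μ := volume)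
        φ.1.continuous (hc φ) hY.snd.snd (f' := fun t ξ => _) (by
          have := continuous_freqSq (n := n)
          have h1 := hY.snd.fst
          have h2 := hY.snd.snd
          fun_prop)
        (fun t ξ => (isPlateMode_plateSymbol σ y₀ ξ).deriv_θ t) t).hasDerivWithinAt (s := Set.Ici 0)
      convert! h1.sub h2 using 1
      have e1 : θt t (𝓕 φ.1) = -θ t (𝓕 (freqMul φ.1)) - σ * θ t (𝓕 φ.1)
          - ut t (𝓕 (freqMul φ.1)) := by
        have := DFunLike.congr_fun (hheat t ht) (𝓕 φ.1)
        have e : θt t (𝓕 φ.1) - (Δ (θ t)) (𝓕 φ.1) + (σ : ℂ) * θ t (𝓕 φ.1)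
            - (Δ (ut t)) (𝓕 φ.1) = 0 := this
        rw [laplacian_apply_fourier, laplacian_apply_fourier] at e
        linear_combination e
      have e2 : ∫ ξ, φ.1 ξ * (-((freqSq ξ + σ) • (plateSymbol σ y₀ t ξ).2.2)
          - freqSq ξ • (plateSymbol σ y₀ t ξ).2.1) =
          -(∫ ξ, (m φ).1 ξ * (plateSymbol σ y₀ t ξ).2.2)
          - σ * (∫ ξ, φ.1 ξ * (plateSymbol σ y₀ t ξ).2.2)
          - ∫ ξ, (m φ).1 ξ * (plateSymbol σ y₀ t ξ).2.1 := by
        have i1 : Integrable fun ξ => -((m φ).1 ξ * (plateSymbol σ y₀ t ξ).2.2) :=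
          (hint _ _ (hYt t).snd.snd).neg
        have i2 := (hint φ _ (hYt t).snd.snd).const_mul (σ : ℂ)
        have i3 := hint (m φ) _ (hYt t).snd.fst
        have i12 : Integrable fun ξ => -((m φ).1 ξ * (plateSymbol σ y₀ t ξ).2.2)
            - σ * (φ.1 ξ * (plateSymbol σ y₀ t ξ).2.2) := i1.sub i2
        rw [← integral_neg, ← integral_const_mul, ← integral_sub i1 i2, ← integral_sub i12 i3]
        congr 1
        ext ξ
        simp only [m, freqMul_apply, Complex.real_smul]
        push_cast
        ring
      rw [e1, e2]
      simp only [V, Θ, m]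
      ring
    · simp only [G, plateSymbol_zero, hsol.displacement_zero, hu₀, sub_self]
    · simp only [V, plateSymbol_zero, hsol.velocity_zero, hu₁, sub_self]
    · simp only [Θ, plateSymbol_zero, hsol.temperature_zero, hθ₀, sub_self]
    -- The a priori bound on `G`: continuity of `u` in `L²` bounds it on `[0, T']`, and the explicit
    -- solution is bounded on a compact set.
    · have hball : volume (Metric.closedBall (0 : EuclideanSpace ℝ (Fin n)) R) ≠ ⊤ :=
        (isCompact_closedBall _ _).measure_ne_top
      obtain ⟨B, hB⟩ := isCompact_Icc.exists_bound_of_continuousOn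
        (hsol.continuousOn.mono (Set.Icc_subset_Ici_self : Set.Icc 0 T' ⊆ Set.Ici 0))
      obtain ⟨B', hB'⟩ := ((isCompact_Icc (a := (0 : ℝ)) (b := T')).prod
        (isCompact_closedBall (0 : EuclideanSpace ℝ (Fin n)) R)).exists_bound_of_continuousOn
          hY.fst.continuousOn
      set ν := volume.real (Metric.closedBall (0 : EuclideanSpace ℝ (Fin n)) R)
      refine ⟨(ν + B ^ 2) + B' * ν, fun φ s hs => ?_⟩
      have h1 : ‖Lp.toTemperedDistribution (u s) (𝓕 φ.1)‖ ≤ p φ * (ν + B ^ 2) := by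
        rw [toTemperedDistribution_fourier_apply]
        refine (norm_integral_mul_le_of_forall_norm_gt φ.2 (hp φ)
          (((Lp.memLp _).locallyIntegrable one_le_two).integrableOn_isCompact
            (isCompact_closedBall _ _))).trans ?_
        have := integral_norm_le_measure_add_norm_sq (𝓕 (u s) : Lp ℂ 2 _) hball
        rw [Lp.norm_fourier_eq] at this
        refine mul_le_mul_of_nonneg_left (this.trans ?_) (norm_nonneg _)
        gcongr
        exact hB s hs
      have h2 : ‖∫ ξ, φ.1 ξ * (plateSymbol σ y₀ s ξ).1‖ ≤ p φ * (B' * ν) := by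
        refine (norm_integral_mul_le_of_forall_norm_gt φ.2 (hp φ)
          ((hYt s).fst.locallyIntegrable.integrableOn_isCompact
            (isCompact_closedBall _ _))).trans ?_
        refine mul_le_mul_of_nonneg_left ?_ (norm_nonneg _)
        have := norm_setIntegral_le_of_norm_le_const (μ := volume) hball.lt_top
          (f := fun ξ => ‖(plateSymbol σ y₀ s ξ).1‖) (C := B') (fun ξ hξ => by
            rw [norm_norm]
            exact hB' (s, ξ) ⟨hs, hξ⟩)
        exact (Real.le_norm_self _).trans this
      calc ‖G φ s‖ ≤ p φ * (ν + B ^ 2) + p φ * (B' * ν) :=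
            (norm_sub_le _ _).trans (add_le_add h1 h2)
        _ = _ := by ring
  rw [← toTemperedDistribution_fourier_apply]
  exact sub_eq_zero.1 key

/-- The Fourier transform of the displacement is given by the mode system. -/
theorem IsThermoelasticPlateSolution.fourier_ae_eq
    (hsol : IsThermoelasticPlateSolution σ u₀ u₁ θ₀ u ut θ) (hσ : 0 ≤ σ)
    (hu₀ : Integrable u₀) (hu₁ : Integrable u₁) (hθ₀ : Integrable θ₀) {T : ℝ} (hT : 0 ≤ T) :
    ((𝓕 (u T) : Lp ℂ 2 _) : EuclideanSpace ℝ (Fin n) → ℂ) =ᵐ[volume]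
      fun ξ => (plateSymbol σ (fourierData u₀ u₁ θ₀) T ξ).1 :=
  hsol.fourier_ae_eq_of_data hσ (continuous_fourierData hu₀ hu₁ hθ₀)
    (toTemperedDistribution_fourier_apply_of_integrable hu₀)
    (toTemperedDistribution_fourier_apply_of_integrable hu₁)
    (toTemperedDistribution_fourier_apply_of_integrable hθ₀) hT

end Representation

/-! ### Upper bound -/

section Upper

variable {n : ℕ}

theorem freqSq_smul (c : ℝ) (ξ : EuclideanSpace ℝ (Fin n)) :
    freqSq (c • ξ) = c ^ 2 * freqSq ξ := by
  simp only [freqSq, norm_smul, Real.norm_eq_abs, mul_pow, sq_abs]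
  ring

theorem norm_sq_le_freqSq (ξ : EuclideanSpace ℝ (Fin n)) : ‖ξ‖ ^ 2 ≤ freqSq ξ := by
  have : (1 : ℝ) ≤ (2 * Real.pi) ^ 2 := by nlinarith [Real.pi_gt_three]
  unfold freqSq
  nlinarith [sq_nonneg ‖ξ‖]

theorem freqSq_pos {ξ : EuclideanSpace ℝ (Fin n)} (hξ : ξ ≠ 0) : 0 < freqSq ξ :=
  lt_of_lt_of_le (by positivity) (norm_sq_le_freqSq ξ)

theorem integral_comp_smul_of_pos (f : EuclideanSpace ℝ (Fin n) → ℝ) {c : ℝ} (hc : 0 < c) :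
    ∫ ξ, f (c • ξ) = (c ^ n)⁻¹ * ∫ ξ, f ξ := by
  rw [Measure.integral_comp_smul, finrank_euclideanSpace_fin, abs_of_pos (by positivity),
    smul_eq_mul]

theorem integrable_inv_one_add_freqSq_sq (hn : n ≤ 3) :
    Integrable fun ξ : EuclideanSpace ℝ (Fin n) => ((1 + freqSq ξ) ^ 2)⁻¹ := by
  have h := integrable_rpow_neg_one_add_norm_sq (E := EuclideanSpace ℝ (Fin n)) (μ := volume)
    (r := 4) (by
      rw [finrank_euclideanSpace_fin]
      have : (n : ℝ) ≤ 3 := by exact_mod_cast hn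
      linarith)
  have hf := continuous_freqSq (n := n)
  refine h.mono' (Continuous.aestronglyMeasurable ?_) (Eventually.of_forall fun ξ => ?_)
  · refine Continuous.inv₀ (by fun_prop) fun ξ => ?_
    have := freqSq_nonneg ξ
    positivity
  · have h0 := freqSq_nonneg ξ
    rw [Real.norm_of_nonneg (by positivity), show (-4 / 2 : ℝ) = -(2 : ℕ) by norm_num,
      Real.rpow_neg (by positivity), Real.rpow_natCast]
    gcongr
    exact norm_sq_le_freqSq ξ

/-- In polar coordinates the density is a multiple of `r^(n-5) e^(-c'r⁴)`; integrability at the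
origin is where `n ≥ 5` enters. -/
theorem integrable_exp_neg_freqSq_sq_div (hn : 5 ≤ n) {c : ℝ} (hc : 0 < c) :
    Integrable fun ξ : EuclideanSpace ℝ (Fin n) =>
      Real.exp (-(c * freqSq ξ ^ 2)) / freqSq ξ ^ 2 := by
  have : Nontrivial (EuclideanSpace ℝ (Fin n)) := by
    have : Nonempty (Fin n) := ⟨⟨0, by omega⟩⟩
    infer_instance
  set b : ℝ := (2 * Real.pi) ^ 2 with hb
  have hb0 : 0 < b := by positivity
  have key := (integrable_fun_norm_addHaar (volume : Measure (EuclideanSpace ℝ (Fin n)))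
    (f := fun r => Real.exp (-(c * (b * r ^ 2) ^ 2)) / (b * r ^ 2) ^ 2)).2 ?_
  · exact key
  · have h := (integrableOn_rpow_mul_exp_neg_mul_rpow (p := 4) (s := (n : ℝ) - 5) (b := c * b ^ 2)
      (by have : (5 : ℝ) ≤ n := by exact_mod_cast hn
          linarith) (by norm_num) (by positivity)).const_mul (b ^ 2)⁻¹
    refine Integrable.congr h ((ae_restrict_iff' measurableSet_Ioi).2
      (Eventually.of_forall fun y hy => ?_))
    have hy0 : (0 : ℝ) < y := hy
    simp only [smul_eq_mul, finrank_euclideanSpace_fin]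
    have e1 : y ^ ((n : ℝ) - 5) * y ^ 4 = y ^ (n - 1) := by
      rw [← Real.rpow_natCast y 4, ← Real.rpow_add hy0, ← Real.rpow_natCast y (n - 1),
        Nat.cast_sub (by omega)]
      congr 1
      push_cast
      ring
    have e2 : y ^ (4 : ℝ) = y ^ 4 := by exact_mod_cast Real.rpow_natCast y 4
    rw [← e1, e2]
    have e3 : -(c * b ^ 2) * y ^ 4 = -(c * (b * y ^ 2) ^ 2) := by ring
    rw [e3]
    field_simp

/-- With `z = 1 + tby²` the integrand is a multiple of `(z-1)/z² dz`, with primitive `log z + 1/z`.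
This is the source of the logarithm for `n = 4`. -/
theorem integral_log_kernel {b t r : ℝ} (hb : 0 < b) (ht : 0 < t) :
    ∫ y in (0)..r, y ^ 3 * (t ^ 2 / (1 + t * (b * y ^ 2)) ^ 2) =
      (2 * b ^ 2)⁻¹ * (Real.log (1 + t * (b * r ^ 2)) + (1 + t * (b * r ^ 2))⁻¹ - 1) := by
  have hpos : ∀ y : ℝ, 0 < 1 + t * (b * y ^ 2) := fun y => by positivity
  have hd : ∀ y ∈ Set.uIcc 0 r, HasDerivAt
      (fun y => (2 * b ^ 2)⁻¹ * (Real.log (1 + t * (b * y ^ 2)) + (1 + t * (b * y ^ 2))⁻¹))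
      (y ^ 3 * (t ^ 2 / (1 + t * (b * y ^ 2)) ^ 2)) y := by
    intro y _
    have h1 : HasDerivAt (fun y : ℝ => 1 + t * (b * y ^ 2)) (t * (b * (2 * y))) y := by
      simpa using (((hasDerivAt_pow 2 y).const_mul b).const_mul t).const_add 1
    have hne := (hpos y).ne'
    convert! ((h1.log hne).add (h1.inv hne)).const_mul (2 * b ^ 2)⁻¹ using 1
    field_simp
    ring
  rw [intervalIntegral.integral_eq_sub_of_hasDerivAt hd]
  · simp
    ring
  · apply Continuous.intervalIntegrable
    refine Continuous.mul (by fun_prop) (Continuous.div (by fun_prop) (by fun_prop) fun y => ?_)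
    exact (pow_pos (hpos y) 2).ne'

theorem integrable_and_integral_log_kernel {t : ℝ} (ht : 2 ≤ t) :
    (Integrable fun ξ : EuclideanSpace ℝ (Fin 4) =>
      (Set.Iic (2 * Real.pi)⁻¹).indicator
        (fun r => t ^ 2 / (1 + t * ((2 * Real.pi) ^ 2 * r ^ 2)) ^ 2) ‖ξ‖) ∧
    ∫ ξ : EuclideanSpace ℝ (Fin 4), (Set.Iic (2 * Real.pi)⁻¹).indicator
        (fun r => t ^ 2 / (1 + t * ((2 * Real.pi) ^ 2 * r ^ 2)) ^ 2) ‖ξ‖ ≤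
      4 * volume.real (Metric.ball (0 : EuclideanSpace ℝ (Fin 4)) 1) * Real.log t := by
  set b : ℝ := (2 * Real.pi) ^ 2 with hb
  have hb1 : 1 ≤ b := by nlinarith [Real.pi_gt_three]
  have hb0 : 0 < b := by linarith
  set r₀ : ℝ := (2 * Real.pi)⁻¹ with hr₀
  have hr₀0 : 0 < r₀ := by positivity
  have hbr : b * r₀ ^ 2 = 1 := by rw [hb, hr₀]; field_simp
  have ht0 : 0 < t := by linarith
  set g : ℝ → ℝ := fun r => t ^ 2 / (1 + t * (b * r ^ 2)) ^ 2
  have hg : Continuous g := by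
    refine Continuous.div (by fun_prop) (by fun_prop) fun y => ?_
    positivity
  have e : ∀ y : ℝ, y ^ (4 - 1) • (Set.Iic r₀).indicator g y
      = (Set.Iic r₀).indicator (fun y => y ^ 3 * g y) y := fun y => by
    by_cases hy : y ∈ Set.Iic r₀ <;> simp [hy]
  have hset : Set.Ioi (0 : ℝ) ∩ Set.Iic r₀ = Set.Ioc 0 r₀ := Set.Ioi_inter_Iic
  constructor
  · refine (integrable_fun_norm_addHaar (volume : Measure (EuclideanSpace ℝ (Fin 4)))).2 ?_
    simp only [finrank_euclideanSpace_fin, e]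
    rw [integrableOn_indicator_iff measurableSet_Iic, Set.inter_comm, hset]
    exact ((continuous_pow 3).mul hg).integrableOn_Ioc
  · rw [integral_fun_norm_addHaar (volume : Measure (EuclideanSpace ℝ (Fin 4)))]
    simp only [finrank_euclideanSpace_fin, e]
    rw [setIntegral_indicator measurableSet_Iic, hset,
      ← intervalIntegral.integral_of_le hr₀0.le, integral_log_kernel hb0 ht0, hbr]
    have hlog : Real.log (1 + t * 1) ≤ 2 * Real.log t := by
      rw [mul_one, show 2 * Real.log t = Real.log (t ^ 2) by rw [Real.log_pow]; norm_num]
      exact Real.log_le_log (by linarith) (by nlinarith)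
    have hinv : (1 + t * 1)⁻¹ ≤ 1 := inv_le_one_of_one_le₀ (by linarith)
    have hlog0 : 0 ≤ Real.log t := Real.log_nonneg (by linarith)
    have h2 : (2 * b ^ 2)⁻¹ * (Real.log (1 + t * 1) + (1 + t * 1)⁻¹ - 1) ≤ Real.log t := by
      calc _ ≤ (2 * b ^ 2)⁻¹ * (2 * Real.log t) := by
            gcongr
            linarith
        _ ≤ (2 * 1 ^ 2)⁻¹ * (2 * Real.log t) := by gcongr
        _ = _ := by ring
    simp only [smul_eq_mul, nsmul_eq_mul]
    push_cast
    rw [← mul_assoc]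
    gcongr

/-- Up to a constant, `t²/(1+tρ)²` is the minimum of `t²` and `1/ρ²`, so it merges the two bounds
into one kernel that is smooth and scales in `tρ`. -/
theorem le_of_low_freq_bounds {t ρ w A : ℝ} (ht : 0 < t) (hρ : 0 ≤ ρ) (hw : 0 ≤ w)
    (h1 : w ≤ 16 * t ^ 2 * A) (h2 : ρ ^ 2 * w ≤ 6 * A) :
    w ≤ 64 * A * (t ^ 2 / (1 + t * ρ) ^ 2) := by
  have hA : 0 ≤ A := by
    have := (mul_nonneg (sq_nonneg ρ) hw).trans h2
    linarith
  rw [← mul_div_assoc, le_div_iff₀ (by positivity)]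
  have hp : (1 + t * ρ) ^ 2 ≤ 2 + 2 * (t * ρ) ^ 2 := by nlinarith [sq_nonneg (1 - t * ρ)]
  calc w * (1 + t * ρ) ^ 2 ≤ w * (2 + 2 * (t * ρ) ^ 2) := by gcongr
    _ = 2 * w + 2 * t ^ 2 * (ρ ^ 2 * w) := by ring
    _ ≤ 2 * (16 * t ^ 2 * A) + 2 * t ^ 2 * (6 * A) := by gcongr
    _ ≤ 64 * A * t ^ 2 := by nlinarith [mul_nonneg (sq_nonneg t) hA]

theorem rateD_nonneg (n : ℕ) {t : ℝ} (ht : 0 ≤ t) : 0 ≤ rateD n t := by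
  unfold rateD
  split_ifs
  · exact Real.rpow_nonneg ht _
  · exact Real.sqrt_nonneg _
  · exact Real.rpow_nonneg ht _

theorem rateD_sq_of_le_three (hn : n ≤ 3) {t : ℝ} (ht : 0 < t) :
    rateD n t ^ 2 = t ^ 2 * (Real.sqrt t ^ n)⁻¹ := by
  rw [rateD, if_pos hn, Real.sqrt_eq_rpow, ← Real.rpow_natCast (t ^ (1 / 2 : ℝ)) n,
    ← Real.rpow_mul ht.le, ← Real.rpow_neg ht.le, ← Real.rpow_natCast t 2, ← Real.rpow_add ht,
    ← Real.rpow_natCast _ 2, ← Real.rpow_mul ht.le]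
  congr 1
  push_cast
  ring

theorem rateD_four_sq {t : ℝ} (ht : 1 ≤ t) : rateD 4 t ^ 2 = Real.log t := by
  rw [rateD, if_neg (by norm_num), if_pos rfl, Real.sq_sqrt (Real.log_nonneg ht)]

theorem rateD_sq_of_five_le (hn : 5 ≤ n) {t : ℝ} (ht : 0 < t) :
    rateD n t ^ 2 = t * ((t ^ (1 / 4 : ℝ)) ^ n)⁻¹ := by
  rw [rateD, if_neg (by omega), if_neg (by omega), ← Real.rpow_natCast (t ^ (1 / 4 : ℝ)) n,
    ← Real.rpow_mul ht.le, ← Real.rpow_neg ht.le, ← Real.rpow_one_add' ht.le (by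
      have : (5 : ℝ) ≤ n := by exact_mod_cast hn
      linarith),
    ← Real.rpow_natCast _ 2, ← Real.rpow_mul ht.le]
  congr 1
  push_cast
  ring

/-- An integrable majorant, of the size of the square of the rate, for the low frequencies. -/
theorem exists_low_freq_majorant (n : ℕ) {c : ℝ} (hc : 0 < c) :
    ∃ C : ℝ, 0 ≤ C ∧ ∀ t : ℝ, 2 ≤ t → ∃ k : EuclideanSpace ℝ (Fin n) → ℝ,
      Integrable k ∧ (∀ ξ, 0 ≤ k ξ) ∧ ∫ ξ, k ξ ≤ C * rateD n t ^ 2 ∧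
      ∀ ξ ≠ 0, freqSq ξ ≤ 1 → ∀ w A : ℝ, 0 ≤ w → w ≤ 16 * t ^ 2 * A →
        freqSq ξ ^ 2 * w ≤ 6 * A * Real.exp (-(c * freqSq ξ ^ 2 * t)) → w ≤ 64 * A * k ξ := by
  have hdrop : ∀ {ρ w A t : ℝ}, 0 ≤ w → 0 ≤ t →
      ρ ^ 2 * w ≤ 6 * A * Real.exp (-(c * ρ ^ 2 * t)) → ρ ^ 2 * w ≤ 6 * A := by
    intro ρ w A t hw ht h
    have hA : 0 ≤ A := by
      have := (mul_nonneg (sq_nonneg ρ) hw).trans h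
      by_contra! hlt
      nlinarith [mul_pos (neg_pos.2 hlt) (Real.exp_pos (-(c * ρ ^ 2 * t)))]
    have : Real.exp (-(c * ρ ^ 2 * t)) ≤ 1 := Real.exp_le_one_iff.2 (by
      have : 0 ≤ c * ρ ^ 2 * t := by positivity
      linarith)
    nlinarith
  rcases Nat.lt_trichotomy n 4 with hn | rfl | hn
  · have hn3 : n ≤ 3 := by omega
    refine ⟨∫ ξ : EuclideanSpace ℝ (Fin n), ((1 + freqSq ξ) ^ 2)⁻¹,
      integral_nonneg fun ξ => by have := freqSq_nonneg ξ; positivity, fun t ht => ?_⟩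
    have ht0 : 0 < t := by linarith
    have hs : 0 < Real.sqrt t := Real.sqrt_pos.2 ht0
    -- The kernel depends on `t|ξ|²`, so rescaling by `√t` extracts the power of `t`; for `n ≥ 5`
    -- below, it depends on `t|ξ|⁴` and the scale is `t^(1/4)`.
    have hk : ∀ ξ : EuclideanSpace ℝ (Fin n), t ^ 2 / (1 + t * freqSq ξ) ^ 2 =
        t ^ 2 * (fun η => ((1 + freqSq η) ^ 2)⁻¹) (Real.sqrt t • ξ) := fun ξ => by
      simp only [freqSq_smul, Real.sq_sqrt ht0.le, div_eq_mul_inv]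
    refine ⟨fun ξ => t ^ 2 / (1 + t * freqSq ξ) ^ 2, ?_, fun ξ => by positivity, ?_, ?_⟩
    · simp only [hk]
      exact ((integrable_inv_one_add_freqSq_sq hn3).comp_smul hs.ne').const_mul _
    · simp only [hk]
      rw [integral_const_mul, integral_comp_smul_of_pos (fun η => ((1 + freqSq η) ^ 2)⁻¹) hs,
        rateD_sq_of_le_three hn3 ht0]
      apply le_of_eq
      ring
    · intro ξ _ _ w A hw h1 h2
      exact le_of_low_freq_bounds ht0 (freqSq_nonneg ξ) hw h1 (hdrop hw ht0.le h2)
  · refine ⟨4 * volume.real (Metric.ball (0 : EuclideanSpace ℝ (Fin 4)) 1), by positivity,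
      fun t ht => ?_⟩
    have ht0 : 0 < t := by linarith
    obtain ⟨hi, hle⟩ := integrable_and_integral_log_kernel ht
    refine ⟨_, hi, fun ξ => Set.indicator_nonneg (fun r _ => by positivity) _, ?_, ?_⟩
    · rw [rateD_four_sq (by linarith)]
      exact hle
    · intro ξ _ hξ w A hw h1 h2
      have hmem : ‖ξ‖ ∈ Set.Iic (2 * Real.pi)⁻¹ := by
        have h3 : (2 * Real.pi * ‖ξ‖) ^ 2 ≤ 1 := by rw [mul_pow]; exact hξ
        have h4 : 2 * Real.pi * ‖ξ‖ ≤ 1 := by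
          have : 0 ≤ 2 * Real.pi * ‖ξ‖ := by positivity
          nlinarith
        rw [Set.mem_Iic, ← one_div, le_div_iff₀ (by positivity)]
        linarith
      rw [Set.indicator_of_mem hmem]
      exact le_of_low_freq_bounds ht0 (freqSq_nonneg ξ) hw h1 (hdrop hw ht0.le h2)
  · have hn5 : 5 ≤ n := hn
    refine ⟨∫ ξ : EuclideanSpace ℝ (Fin n), Real.exp (-(c * freqSq ξ ^ 2)) / freqSq ξ ^ 2,
      integral_nonneg fun ξ => by positivity, fun t ht => ?_⟩
    have ht0 : 0 < t := by linarith
    set s : ℝ := t ^ (1 / 4 : ℝ) with hsdef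
    have hs : 0 < s := Real.rpow_pos_of_pos ht0 _
    have hs4 : s ^ 4 = t := by
      rw [hsdef, ← Real.rpow_natCast, ← Real.rpow_mul ht0.le]
      norm_num
    have hk : ∀ ξ : EuclideanSpace ℝ (Fin n), Real.exp (-(c * freqSq ξ ^ 2 * t)) / freqSq ξ ^ 2 =
        t * (fun η => Real.exp (-(c * freqSq η ^ 2)) / freqSq η ^ 2) (s • ξ) := fun ξ => by
      simp only [freqSq_smul]
      have : (s ^ 2 * freqSq ξ) ^ 2 = t * freqSq ξ ^ 2 := by rw [← hs4]; ring
      rw [this]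
      have e : c * (t * freqSq ξ ^ 2) = c * freqSq ξ ^ 2 * t := by ring
      rw [e, ← mul_div_assoc, mul_div_mul_left _ _ ht0.ne']
    refine ⟨fun ξ => Real.exp (-(c * freqSq ξ ^ 2 * t)) / freqSq ξ ^ 2, ?_,
      fun ξ => by positivity, ?_, ?_⟩
    · simp only [hk]
      exact ((integrable_exp_neg_freqSq_sq_div hn5 hc).comp_smul hs.ne').const_mul _
    · simp only [hk]
      rw [integral_const_mul, integral_comp_smul_of_pos
        (fun η => Real.exp (-(c * freqSq η ^ 2)) / freqSq η ^ 2) hs,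
        rateD_sq_of_five_le hn5 ht0]
      apply le_of_eq
      ring
    · intro ξ hξ _ w A hw _ h2
      have hpos := freqSq_pos hξ
      have hA : 0 ≤ A := by
        have := (mul_nonneg (sq_nonneg (freqSq ξ)) hw).trans h2
        by_contra! hlt
        nlinarith [mul_pos (neg_pos.2 hlt) (Real.exp_pos (-(c * freqSq ξ ^ 2 * t)))]
      rw [← mul_div_assoc, le_div_iff₀ (by positivity), mul_comm w]
      refine h2.trans ?_
      gcongr
      norm_num

/-- Makes the exponentially small contribution of the frequencies with `freqSq ξ ≥ 1` negligible. -/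
theorem eventually_exp_le_rateD_sq (n : ℕ) {c : ℝ} (hc : 0 < c) :
    ∀ᶠ t : ℝ in atTop, Real.exp (-c * t) ≤ rateD n t ^ 2 := by
  have hpow : ∀ b : ℝ, ∀ᶠ t : ℝ in atTop, Real.exp (-c * t) ≤ (t ^ b) ^ 2 := fun b => by
    have h := (isLittleO_exp_neg_mul_rpow_atTop hc (b * 2)).bound one_pos
    filter_upwards [h, eventually_gt_atTop 0] with t ht ht0
    rw [one_mul, Real.norm_of_nonneg (Real.exp_pos _).le,
      Real.norm_of_nonneg (Real.rpow_nonneg ht0.le _)] at ht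
    rwa [← Real.rpow_natCast, ← Real.rpow_mul ht0.le]
  unfold rateD
  split_ifs with h1 h2
  · exact hpow _
  · filter_upwards [eventually_ge_atTop (Real.exp 1)] with t ht
    have ht0 : 0 < t := (Real.exp_pos 1).trans_le ht
    have h1 : 1 ≤ Real.log t := (Real.le_log_iff_exp_le ht0).2 ht
    rw [Real.sq_sqrt (by linarith)]
    exact (Real.exp_le_one_iff.2 (by nlinarith)).trans h1
  · exact hpow _

variable {σ : ℝ}

/-- Pointwise bounds for the displacement of a mode. -/
theorem IsPlateMode.norm_u_bounds {ρ : ℝ} {u v θ : ℝ → ℂ} (h : IsPlateMode ρ σ u v θ)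
    (hσ : 0 < σ) (hρ : 0 ≤ ρ) {t M : ℝ} (ht : 1 ≤ t)
    (hu : ‖u 0‖ ≤ M) (hv : ‖v 0‖ ≤ M) (hθ : ‖θ 0‖ ≤ M) :
    (ρ ≤ 1 → ‖u t‖ ^ 2 ≤ 16 * t ^ 2 * M ^ 2 ∧
      ρ ^ 2 * ‖u t‖ ^ 2 ≤ 6 * M ^ 2 * Real.exp (-((20 * (1 + σ))⁻¹ * ρ ^ 2 * t))) ∧
    (1 ≤ ρ → ‖u t‖ ^ 2 ≤ 2 * Real.exp (-(20 * (1 + σ))⁻¹ * t) *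
      (‖u 0‖ ^ 2 + ‖v 0‖ ^ 2 + ‖θ 0‖ ^ 2)) := by
  have hM : 0 ≤ M := (norm_nonneg _).trans hu
  have ht0 : 0 ≤ t := by linarith
  have hE := h.energy_decay hσ hρ ht0
  have hu2 : ‖u 0‖ ^ 2 ≤ M ^ 2 := by gcongr
  have hv2 : ‖v 0‖ ^ 2 ≤ M ^ 2 := by gcongr
  have hθ2 : ‖θ 0‖ ^ 2 ≤ M ^ 2 := by gcongr
  constructor
  · intro hρ1
    have hρ2 : (ρ * ‖u 0‖) ^ 2 ≤ M ^ 2 := by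
      rw [mul_pow]
      calc ρ ^ 2 * ‖u 0‖ ^ 2 ≤ 1 ^ 2 * M ^ 2 := by gcongr
        _ = _ := by ring
    constructor
    -- Energy decay gives `|v|² ≤ 6M² ≤ (3M)²`; integrating, `|u| ≤ M + 3Mt ≤ 4Mt` since `t ≥ 1`.
    · have hvs : ∀ s, 0 ≤ s → ‖v s‖ ≤ 3 * M := by
        intro s hs
        have h1 := h.energy_decay hσ hρ hs
        have h2 : Real.exp (-(ρ ^ 2 / (20 * (ρ + σ)) * s)) ≤ 1 := Real.exp_le_one_iff.2 (by
          have : 0 ≤ ρ ^ 2 / (20 * (ρ + σ)) * s := by positivity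
          linarith)
        have h3 : ‖v s‖ ^ 2 ≤ (3 * M) ^ 2 := by
          have h4 : 2 * Real.exp (-(ρ ^ 2 / (20 * (ρ + σ)) * s)) *
              (‖v 0‖ ^ 2 + (ρ * ‖u 0‖) ^ 2 + ‖θ 0‖ ^ 2) ≤ 2 * 1 * (M ^ 2 + M ^ 2 + M ^ 2) := by
            gcongr
          nlinarith [sq_nonneg (ρ * ‖u s‖), sq_nonneg ‖θ s‖]
        exact (sq_le_sq₀ (norm_nonneg _) (by positivity)).1 h3
      have h5 := h.norm_u_le ht0 hvs
      have h6 : ‖u t‖ ≤ 4 * t * M := by nlinarith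
      calc ‖u t‖ ^ 2 ≤ (4 * t * M) ^ 2 := by gcongr
        _ = _ := by ring
    · have hk : (20 * (1 + σ))⁻¹ * ρ ^ 2 * t ≤ ρ ^ 2 / (20 * (ρ + σ)) * t := by
        rw [div_eq_inv_mul]
        rcases hρ.eq_or_lt with rfl | hpos
        · simp
        · gcongr
      calc ρ ^ 2 * ‖u t‖ ^ 2 ≤ ‖v t‖ ^ 2 + (ρ * ‖u t‖) ^ 2 + ‖θ t‖ ^ 2 := by
            nlinarith [sq_nonneg ‖v t‖, sq_nonneg ‖θ t‖]
        _ ≤ _ := hE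
        _ ≤ 2 * Real.exp (-((20 * (1 + σ))⁻¹ * ρ ^ 2 * t)) * (M ^ 2 + M ^ 2 + M ^ 2) := by
            gcongr
        _ = _ := by ring
  · intro hρ1
    have hk : (20 * (1 + σ))⁻¹ ≤ ρ ^ 2 / (20 * (ρ + σ)) := by
      rw [← one_div, div_le_div_iff₀ (by positivity) (by positivity)]
      nlinarith [mul_nonneg hρ hσ.le, mul_le_mul hρ1 hρ1 zero_le_one hρ]
    have hρ2 : 1 ≤ ρ ^ 2 := one_le_pow₀ hρ1
    have h1 : ρ ^ 2 * ‖u t‖ ^ 2 ≤ ρ ^ 2 * (2 * Real.exp (-(20 * (1 + σ))⁻¹ * t) *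
        (‖u 0‖ ^ 2 + ‖v 0‖ ^ 2 + ‖θ 0‖ ^ 2)) := by
      calc ρ ^ 2 * ‖u t‖ ^ 2 ≤ ‖v t‖ ^ 2 + (ρ * ‖u t‖) ^ 2 + ‖θ t‖ ^ 2 := by
            nlinarith [sq_nonneg ‖v t‖, sq_nonneg ‖θ t‖]
        _ ≤ _ := hE
        _ ≤ 2 * Real.exp (-((20 * (1 + σ))⁻¹ * t)) *
            (ρ ^ 2 * ‖v 0‖ ^ 2 + (ρ * ‖u 0‖) ^ 2 + ρ ^ 2 * ‖θ 0‖ ^ 2) := by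
            gcongr
            · exact le_mul_of_one_le_left (sq_nonneg _) hρ2
            · exact le_mul_of_one_le_left (sq_nonneg _) hρ2
        _ = _ := by rw [neg_mul]; ring
    exact le_of_mul_le_mul_left h1 (by positivity)

/-- The single number `M` controls the data both pointwise, for `freqSq ξ ≤ 1`, and in mean square,
for `freqSq ξ ≥ 1`: the `L¹` and `L²` parts of the norm. -/
theorem exists_integral_plateSymbol_sq_le (hn : 1 ≤ n) (hσ : 0 < σ) :
    ∃ C T : ℝ, 0 < C ∧ ∀ t, T ≤ t → ∀ (y₀ : EuclideanSpace ℝ (Fin n) → ℂ × ℂ × ℂ) (M : ℝ),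
      (∀ ξ, ‖(y₀ ξ).1‖ ≤ M) → (∀ ξ, ‖(y₀ ξ).2.1‖ ≤ M) → (∀ ξ, ‖(y₀ ξ).2.2‖ ≤ M) →
      Integrable (fun ξ => ‖(y₀ ξ).1‖ ^ 2 + ‖(y₀ ξ).2.1‖ ^ 2 + ‖(y₀ ξ).2.2‖ ^ 2) →
      ∫ ξ, (‖(y₀ ξ).1‖ ^ 2 + ‖(y₀ ξ).2.1‖ ^ 2 + ‖(y₀ ξ).2.2‖ ^ 2) ≤ 3 * M ^ 2 →
      ∫ ξ, ‖(plateSymbol σ y₀ t ξ).1‖ ^ 2 ≤ C * rateD n t ^ 2 * M ^ 2 := by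
  have : Nontrivial (EuclideanSpace ℝ (Fin n)) := by
    have : Nonempty (Fin n) := ⟨⟨0, by omega⟩⟩
    infer_instance
  have hc : 0 < (20 * (1 + σ))⁻¹ := by positivity
  obtain ⟨C, hC, hmaj⟩ := exists_low_freq_majorant n hc
  obtain ⟨T, hT⟩ := eventually_atTop.1 (eventually_exp_le_rateD_sq n hc)
  refine ⟨64 * C + 6, max T 2, by positivity, fun t ht y₀ M h0 h1 h2 hi hle => ?_⟩
  obtain ⟨k, hki, hk0, hkC, hk⟩ := hmaj t ((le_max_right _ _).trans ht)
  have ht2 : 2 ≤ t := (le_max_right _ _).trans ht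
  have hexp := hT t ((le_max_left _ _).trans ht)
  have hne : ∀ᵐ ξ : EuclideanSpace ℝ (Fin n), ξ ≠ 0 := by
    simp [ae_iff]
  calc ∫ ξ, ‖(plateSymbol σ y₀ t ξ).1‖ ^ 2
      ≤ ∫ ξ, (64 * M ^ 2 * k ξ + 2 * Real.exp (-(20 * (1 + σ))⁻¹ * t) *
        (‖(y₀ ξ).1‖ ^ 2 + ‖(y₀ ξ).2.1‖ ^ 2 + ‖(y₀ ξ).2.2‖ ^ 2)) := by
        apply integral_mono_of_nonneg (Eventually.of_forall fun ξ => by positivity)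
          ((hki.const_mul _).add (hi.const_mul _))
        filter_upwards [hne] with ξ hξ
        have hb := (isPlateMode_plateSymbol σ y₀ ξ).norm_u_bounds hσ (freqSq_nonneg ξ)
          (t := t) (M := M) (by linarith) (by simpa [plateSymbol_zero] using h0 ξ)
          (by simpa [plateSymbol_zero] using h1 ξ) (by simpa [plateSymbol_zero] using h2 ξ)
        simp only [plateSymbol_zero] at hb
        have hk0 := hk0 ξ
        change _ ≤ 64 * M ^ 2 * k ξ + 2 * Real.exp (-(20 * (1 + σ))⁻¹ * t) *
          (‖(y₀ ξ).1‖ ^ 2 + ‖(y₀ ξ).2.1‖ ^ 2 + ‖(y₀ ξ).2.2‖ ^ 2)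
        rcases le_total (freqSq ξ) 1 with hρ | hρ
        · have := hk ξ hξ hρ _ (M ^ 2) (sq_nonneg _) (hb.1 hρ).1 (hb.1 hρ).2
          refine this.trans (le_add_of_nonneg_right (by positivity))
        · exact (hb.2 hρ).trans (le_add_of_nonneg_left (by positivity))
    _ = 64 * M ^ 2 * (∫ ξ, k ξ) + 2 * Real.exp (-(20 * (1 + σ))⁻¹ * t) *
        ∫ ξ, (‖(y₀ ξ).1‖ ^ 2 + ‖(y₀ ξ).2.1‖ ^ 2 + ‖(y₀ ξ).2.2‖ ^ 2) := by
        rw [integral_add (hki.const_mul _) (hi.const_mul _), integral_const_mul,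
          integral_const_mul]
    _ ≤ 64 * M ^ 2 * (C * rateD n t ^ 2) + 2 * rateD n t ^ 2 * (3 * M ^ 2) := by
        gcongr
    _ = _ := by ring

end Upper

/-! ### Lower bound on annuli in frequency space -/

section Lower

variable {n : ℕ}

/-- The factor `y` gives an exact primitive. Since `sin²` averages to `1/2`, the main term is `3/32`
of `r₂² - r₁²`; the oscillating remainder is at most `2/32` of it by `hat`. -/
theorem le_integral_oscillation {b t r₁ r₂ : ℝ} (hb : 0 < b) (ht : 0 < t)
    (hat : 2 ≤ b * (r₂ ^ 2 - r₁ ^ 2) * t) :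
    (r₂ ^ 2 - r₁ ^ 2) / 32 ≤
      ∫ y in r₁..r₂, y * (Real.sin (b * y ^ 2 * t) ^ 2 / 2 - 1 / 16) := by
  have hd : ∀ y ∈ Set.uIcc r₁ r₂, HasDerivAt
      (fun y => 3 / 32 * y ^ 2 - Real.sin (2 * (b * y ^ 2 * t)) / (16 * b * t))
      (y * (Real.sin (b * y ^ 2 * t) ^ 2 / 2 - 1 / 16)) y := by
    intro y _
    have h1 : HasDerivAt (fun y : ℝ => 2 * (b * y ^ 2 * t)) (2 * (b * (2 * y) * t)) y := by
      simpa using (((hasDerivAt_pow 2 y).const_mul b).mul_const t).const_mul 2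
    convert! ((hasDerivAt_pow 2 y).const_mul (3 / 32 : ℝ)).sub (h1.sin.div_const (16 * b * t))
      using 1
    rw [Real.cos_two_mul, Real.cos_sq']
    field_simp
    push_cast
    ring
  rw [intervalIntegral.integral_eq_sub_of_hasDerivAt hd
    (Continuous.intervalIntegrable (by fun_prop) _ _)]
  have h1 := Real.sin_le_one (2 * (b * r₂ ^ 2 * t))
  have h2 := Real.neg_one_le_sin (2 * (b * r₁ ^ 2 * t))
  have h3 : Real.sin (2 * (b * r₂ ^ 2 * t)) / (16 * b * t)
      - Real.sin (2 * (b * r₁ ^ 2 * t)) / (16 * b * t) ≤ (r₂ ^ 2 - r₁ ^ 2) / 16 := by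
    rw [← sub_div, div_le_div_iff₀ (by positivity) (by norm_num)]
    nlinarith
  linarith

/-- The positive part of the oscillating factor. -/
noncomputable def oscWeight (x : ℝ) : ℝ := max 0 (Real.sin x ^ 2 / 2 - 1 / 16)

theorem continuous_oscWeight : Continuous oscWeight := by
  unfold oscWeight; fun_prop

theorem oscWeight_nonneg (x : ℝ) : 0 ≤ oscWeight x := le_max_left _ _

/-- A half-open annulus in frequency space. -/
def freqAnnulus (n : ℕ) (a b : ℝ) : Set (EuclideanSpace ℝ (Fin n)) :=
  {ξ | a ≤ freqSq ξ ∧ freqSq ξ < b}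

theorem measurableSet_freqAnnulus (a b : ℝ) : MeasurableSet (freqAnnulus n a b) :=
  (measurableSet_le measurable_const continuous_freqSq.measurable).inter
    (measurableSet_lt continuous_freqSq.measurable measurable_const)

theorem freqAnnulus_subset_closedBall (a b : ℝ) :
    freqAnnulus n a b ⊆ Metric.closedBall 0 (Real.sqrt b) := fun ξ hξ => by
  rw [mem_closedBall_zero_iff]
  exact Real.le_sqrt_of_sq_le ((norm_sq_le_freqSq ξ).trans hξ.2.le)

theorem integrableOn_freqAnnulus {f : EuclideanSpace ℝ (Fin n) → ℝ} (hf : Continuous f) (a b : ℝ) :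
    IntegrableOn f (freqAnnulus n a b) :=
  (hf.locallyIntegrable.integrableOn_isCompact (isCompact_closedBall _ _)).mono_set
    (freqAnnulus_subset_closedBall a b)

theorem exists_le_integral_oscWeight (hn : 1 ≤ n) :
    ∃ c : ℝ, 0 < c ∧ ∀ a t : ℝ, 0 < a → 0 < t → 2 ≤ a * t →
      c * Real.sqrt a ^ n ≤ ∫ ξ in freqAnnulus n a (2 * a), oscWeight (freqSq ξ * t) := by
  have : Nontrivial (EuclideanSpace ℝ (Fin n)) := by
    have : Nonempty (Fin n) := ⟨⟨0, by omega⟩⟩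
    infer_instance
  set ν := volume.real (Metric.ball (0 : EuclideanSpace ℝ (Fin n)) 1)
  have hν : 0 < ν := ENNReal.toReal_pos (Metric.measure_ball_pos _ _ one_pos).ne' measure_ball_lt_top.ne
  have hn0 : (0 : ℝ) < n := by exact_mod_cast hn
  refine ⟨n * ν * (64 * (2 * Real.pi) ^ n)⁻¹, by positivity, fun a t ha ht hat => ?_⟩
  set b : ℝ := (2 * Real.pi) ^ 2 with hb
  have hb0 : 0 < b := by positivity
  set r₁ := Real.sqrt a / (2 * Real.pi) with hr₁
  set r₂ := Real.sqrt (2 * a) / (2 * Real.pi) with hr₂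
  have hr₁0 : 0 < r₁ := by positivity
  have hr₂0 : 0 < r₂ := by positivity
  have e₁ : b * r₁ ^ 2 = a := by
    rw [hr₁, hb, div_pow, Real.sq_sqrt ha.le]; field_simp
  have e₂ : b * r₂ ^ 2 = 2 * a := by
    rw [hr₂, hb, div_pow, Real.sq_sqrt (by positivity)]; field_simp
  have hr : r₁ ≤ r₂ := by
    rw [hr₁, hr₂]; gcongr; linarith
  have hr2 : r₂ ≤ 2 * r₁ := by
    have : r₂ ^ 2 ≤ (2 * r₁) ^ 2 := by
      have : b * r₂ ^ 2 ≤ b * (2 * r₁) ^ 2 := by nlinarith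
      exact le_of_mul_le_mul_left this hb0
    exact (sq_le_sq₀ hr₂0.le (by positivity)).1 this
  have hmem : ∀ y : ℝ, 0 < y → (a ≤ b * y ^ 2 ∧ b * y ^ 2 < 2 * a ↔ y ∈ Set.Ico r₁ r₂) := by
    intro y hy
    rw [← e₁, Set.mem_Ico, mul_le_mul_iff_right₀ hb0, sq_le_sq₀ hr₁0.le hy.le, e₁, ← e₂,
      mul_lt_mul_iff_right₀ hb0, sq_lt_sq₀ hy.le hr₂0.le]
  let A : Set ℝ := {y | a ≤ b * y ^ 2 ∧ b * y ^ 2 < 2 * a}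
  let f : ℝ → ℝ := A.indicator fun y => oscWeight (b * y ^ 2 * t)
  have hf : ∫ ξ in freqAnnulus n a (2 * a), oscWeight (freqSq ξ * t)
      = ∫ ξ : EuclideanSpace ℝ (Fin n), f ‖ξ‖ := by
    rw [← integral_indicator (measurableSet_freqAnnulus a (2 * a))]
    rfl
  have hf₁ : ∀ y, 0 < y → y ∈ Set.Ico r₁ r₂ → f y = oscWeight (b * y ^ 2 * t) := fun y hy h =>
    Set.indicator_of_mem (show y ∈ A from (hmem y hy).2 h) _
  have hf₂ : ∀ y, 0 < y → y ∉ Set.Ico r₁ r₂ → f y = 0 := fun y hy h =>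
    Set.indicator_of_notMem (fun h' : y ∈ A => h ((hmem y hy).1 h')) _
  have hcont : Continuous fun y : ℝ => y ^ (n - 1) * oscWeight (b * y ^ 2 * t) :=
    (continuous_pow _).mul (continuous_oscWeight.comp (by fun_prop))
  have hpolar : ∫ y in Set.Ioi (0 : ℝ), y ^ (n - 1) • f y
      = ∫ y in r₁..r₂, y ^ (n - 1) * oscWeight (b * y ^ 2 * t) := by
    rw [intervalIntegral.integral_of_le hr, ← integral_Ico_eq_integral_Ioc,
      ← integral_indicator measurableSet_Ioi, ← integral_indicator measurableSet_Ico]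
    congr 1
    ext y
    by_cases hy : 0 < y
    · rw [Set.indicator_of_mem (Set.mem_Ioi.2 hy)]
      by_cases hy' : y ∈ Set.Ico r₁ r₂
      · rw [Set.indicator_of_mem hy', hf₁ y hy hy', smul_eq_mul]
      · rw [Set.indicator_of_notMem hy', hf₂ y hy hy', smul_zero]
    · rw [Set.indicator_of_notMem (fun h => hy (Set.mem_Ioi.1 h)),
        Set.indicator_of_notMem (fun h => hy (hr₁0.trans_le h.1))]
  rw [hf, integral_fun_norm_addHaar (volume : Measure (EuclideanSpace ℝ (Fin n)))]
  rw [finrank_euclideanSpace_fin, hpolar, smul_eq_mul, nsmul_eq_mul]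
  have hosc := le_integral_oscillation (b := b) (t := t) (r₁ := r₁) (r₂ := r₂) hb0 ht (by
    rw [mul_sub, e₁, e₂]; linarith)
  have hdiff : r₂ ^ 2 - r₁ ^ 2 = r₁ ^ 2 := by
    have : b * r₂ ^ 2 = b * (2 * r₁ ^ 2) := by linarith
    have := mul_left_cancel₀ hb0.ne' this
    linarith
  rw [hdiff] at hosc
  -- On the annulus `r₁ ≤ y ≤ 2r₁`, so the polar weight `y^(n-1)` dominates a constant multiple of
  -- `y`, the only weight with an elementary primitive here. The sine factor may be negative, hence
  -- `oscWeight`.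
  have hint : r₁ ^ (n - 1) / (2 * r₁) * (r₁ ^ 2 / 32)
      ≤ ∫ y in r₁..r₂, y ^ (n - 1) * oscWeight (b * y ^ 2 * t) := by
    calc _ ≤ r₁ ^ (n - 1) / (2 * r₁) *
          ∫ y in r₁..r₂, y * (Real.sin (b * y ^ 2 * t) ^ 2 / 2 - 1 / 16) := by gcongr
      _ = ∫ y in r₁..r₂, r₁ ^ (n - 1) / (2 * r₁) *
          (y * (Real.sin (b * y ^ 2 * t) ^ 2 / 2 - 1 / 16)) := by
          rw [intervalIntegral.integral_const_mul]
      _ ≤ _ := by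
          apply intervalIntegral.integral_mono_on hr
            (Continuous.intervalIntegrable (by fun_prop) _ _) (hcont.intervalIntegrable _ _)
          intro y hy
          have hy0 : 0 < y := hr₁0.trans_le hy.1
          have h1 : r₁ ^ (n - 1) / (2 * r₁) * y ≤ y ^ (n - 1) := by
            rw [div_mul_eq_mul_div, div_le_iff₀ (by positivity)]
            have := hy.1
            have := hy.2.trans hr2
            gcongr
          calc _ = r₁ ^ (n - 1) / (2 * r₁) * y * (Real.sin (b * y ^ 2 * t) ^ 2 / 2 - 1 / 16) := by
                ring
            _ ≤ r₁ ^ (n - 1) / (2 * r₁) * y * oscWeight (b * y ^ 2 * t) := by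
                gcongr
                exact le_max_right _ _
            _ ≤ _ := by
                gcongr
                exact oscWeight_nonneg _
  have hr₁n : r₁ ^ (n - 1) / (2 * r₁) * (r₁ ^ 2 / 32) = r₁ ^ n / 64 := by
    obtain ⟨k, rfl⟩ : ∃ k, n = k + 1 := ⟨n - 1, by omega⟩
    rw [Nat.add_sub_cancel, pow_succ]
    field_simp
    ring
  rw [hr₁n] at hint
  have e : Real.sqrt a ^ n = r₁ ^ n * (2 * Real.pi) ^ n := by
    rw [← mul_pow, hr₁]
    field_simp
  calc n * ν * (64 * (2 * Real.pi) ^ n)⁻¹ * Real.sqrt a ^ n = n * (ν * (r₁ ^ n / 64)) := by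
        rw [e]; field_simp
    _ ≤ _ := mul_le_mul_of_nonneg_left (mul_le_mul_of_nonneg_left hint hν.le) hn0.le

variable {σ : ℝ}

theorem IsPlateMode.oscWeight_le {ρ : ℝ} {u v θ : ℝ → ℂ} (h : IsPlateMode ρ σ u v θ)
    (hσ : 0 < σ) (hρ : 0 ≤ ρ) {t p : ℝ} (ht : 0 ≤ t) (hρt : ρ ^ 2 * t ≤ σ / 16) (hp : 0 ≤ p)
    (hv : p / 2 ≤ ‖v 0‖) (hu : 2 * ρ * (‖u 0‖ + ‖θ 0‖ / σ) ≤ ‖v 0‖ / 8) :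
    p ^ 2 / 4 * oscWeight (ρ * t) ≤ ρ ^ 2 * ‖u t‖ ^ 2 := by
  have hl := h.le_norm_u hσ hρ ht hρt
  set s := |Real.sin (ρ * t)| with hs
  have hsq : Real.sin (ρ * t) ^ 2 = s ^ 2 := (sq_abs _).symm
  have hs0 : 0 ≤ s := abs_nonneg _
  have h1 : (s - 1 / 4) * ‖v 0‖ ≤ ρ * ‖u t‖ := by linarith
  rw [← mul_pow]
  rcases le_or_gt (Real.sin (ρ * t) ^ 2 / 2 - 1 / 16) 0 with h2 | h2
  · rw [oscWeight, max_eq_left h2, mul_zero]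
    positivity
  · rw [oscWeight, max_eq_right h2.le]
    rw [hsq] at h2 ⊢
    have h3 : 0 ≤ s - 1 / 4 := by nlinarith
    -- The difference is `(s - 1/2)²/2`; this explains the constants in `oscWeight`.
    have h4 : s ^ 2 / 2 - 1 / 16 ≤ (s - 1 / 4) ^ 2 := by nlinarith [sq_nonneg (s - 1 / 2)]
    calc p ^ 2 / 4 * (s ^ 2 / 2 - 1 / 16) = (p / 2) ^ 2 * (s ^ 2 / 2 - 1 / 16) := by ring
      _ ≤ ‖v 0‖ ^ 2 * (s - 1 / 4) ^ 2 := by gcongr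
      _ = ((s - 1 / 4) * ‖v 0‖) ^ 2 := by ring
      _ ≤ _ := by gcongr

/-- Near frequency zero the velocity data dominates. -/
theorem exists_low_freq_data {y₀ : EuclideanSpace ℝ (Fin n) → ℂ × ℂ × ℂ} (hy : Continuous y₀)
    (hσ : 0 < σ) {M : ℝ} (h0 : ∀ ξ, ‖(y₀ ξ).1‖ ≤ M) (h2 : ∀ ξ, ‖(y₀ ξ).2.2‖ ≤ M)
    (hp : (y₀ 0).2.1 ≠ 0) :
    ∃ δ : ℝ, 0 < δ ∧ ∀ ξ, freqSq ξ < δ → ‖(y₀ 0).2.1‖ / 2 ≤ ‖(y₀ ξ).2.1‖ ∧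
      2 * freqSq ξ * (‖(y₀ ξ).1‖ + ‖(y₀ ξ).2.2‖ / σ) ≤ ‖(y₀ ξ).2.1‖ / 8 := by
  set p := ‖(y₀ 0).2.1‖ with hpdef
  have hp0 : 0 < p := norm_pos_iff.2 hp
  have hM : 0 ≤ M := (norm_nonneg _).trans (h0 0)
  have hcont : Continuous fun ξ => ‖(y₀ ξ).2.1‖ := hy.snd.fst.norm
  have hev : ∀ᶠ ξ in nhds (0 : EuclideanSpace ℝ (Fin n)), p / 2 < ‖(y₀ ξ).2.1‖ :=
    hcont.continuousAt.eventually (lt_mem_nhds (by simp only [← hpdef]; linarith))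
  obtain ⟨ε, hε, hball⟩ := Metric.eventually_nhds_iff.1 hev
  -- The `+ 1` keeps `K` positive when `M = 0`.
  set K := 2 * (M + M / σ) + 1 with hK
  have hK0 : 0 < K := by positivity
  refine ⟨min (ε ^ 2) (p / (16 * K)), by positivity, fun ξ hξ => ?_⟩
  have hξε : ‖ξ‖ < ε := by
    have h3 := (norm_sq_le_freqSq ξ).trans_lt (hξ.trans_le (min_le_left _ _))
    exact (sq_lt_sq₀ (norm_nonneg _) hε.le).1 h3
  have h1 : p / 2 < ‖(y₀ ξ).2.1‖ := hball (by simpa using hξε)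
  refine ⟨h1.le, ?_⟩
  have hρ := freqSq_nonneg ξ
  have h4 : freqSq ξ * (16 * K) ≤ p := by
    have := (hξ.trans_le (min_le_right _ _)).le
    rwa [le_div_iff₀ (by positivity)] at this
  calc 2 * freqSq ξ * (‖(y₀ ξ).1‖ + ‖(y₀ ξ).2.2‖ / σ) ≤ 2 * freqSq ξ * (M + M / σ) := by
        gcongr
        exacts [h0 ξ, h2 ξ]
    _ ≤ freqSq ξ * K := by rw [hK]; nlinarith
    _ ≤ p / 16 := by linarith
    _ ≤ _ := by linarith

/-- Lower bound for the mass of the displacement in one dyadic annulus. -/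
theorem exists_le_setIntegral_plateSymbol (hn : 1 ≤ n) (hσ : 0 < σ) :
    ∃ c : ℝ, 0 < c ∧ ∀ (y₀ : EuclideanSpace ℝ (Fin n) → ℂ × ℂ × ℂ) (M : ℝ), Continuous y₀ →
      (∀ ξ, ‖(y₀ ξ).1‖ ≤ M) → (∀ ξ, ‖(y₀ ξ).2.2‖ ≤ M) → (y₀ 0).2.1 ≠ 0 →
      ∃ δ : ℝ, 0 < δ ∧ ∀ a t : ℝ, 0 < a → 0 < t → 2 ≤ a * t → (2 * a) ^ 2 * t ≤ σ / 16 →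
        2 * a ≤ δ → c * (Real.sqrt a ^ n / a ^ 2) * ‖(y₀ 0).2.1‖ ^ 2 ≤
          ∫ ξ in freqAnnulus n a (2 * a), ‖(plateSymbol σ y₀ t ξ).1‖ ^ 2 := by
  obtain ⟨c, hc, hosc⟩ := exists_le_integral_oscWeight hn
  refine ⟨c / 16, by positivity, fun y₀ M hy h0 h2 hp => ?_⟩
  obtain ⟨δ, hδ, hdata⟩ := exists_low_freq_data hy hσ h0 h2 hp
  refine ⟨δ, hδ, fun a t ha ht hat haσ haδ => ?_⟩
  set p := ‖(y₀ 0).2.1‖ with hpdef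
  calc c / 16 * (Real.sqrt a ^ n / a ^ 2) * p ^ 2
      = p ^ 2 / 4 / (2 * a) ^ 2 * (c * Real.sqrt a ^ n) := by field_simp; ring
    _ ≤ p ^ 2 / 4 / (2 * a) ^ 2 *
        ∫ ξ in freqAnnulus n a (2 * a), oscWeight (freqSq ξ * t) := by
        gcongr
        exact hosc a t ha ht hat
    _ = ∫ ξ in freqAnnulus n a (2 * a), p ^ 2 / 4 / (2 * a) ^ 2 * oscWeight (freqSq ξ * t) := by
        rw [integral_const_mul]
    _ ≤ _ := by
        refine setIntegral_mono_on
          ((integrableOn_freqAnnulus (continuous_oscWeight.comp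
            (continuous_freqSq.mul continuous_const)) _ _).const_mul _)
          (integrableOn_freqAnnulus ((continuous_plateSymbol_apply σ hy t).fst.norm.pow 2)
            _ _) (measurableSet_freqAnnulus _ _) fun ξ hξ => ?_
        obtain ⟨hξ1, hξ2⟩ := hξ
        have hρ : 0 < freqSq ξ := ha.trans_le hξ1
        obtain ⟨d1, d2⟩ := hdata ξ (hξ2.trans_le haδ)
        have := (isPlateMode_plateSymbol σ y₀ ξ).oscWeight_le hσ hρ.le (t := t) (p := p) ht.le
          (by
            refine le_trans ?_ haσ
            gcongr) (norm_nonneg _)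
          (by simpa [plateSymbol_zero] using d1) (by simpa [plateSymbol_zero] using d2)
        rw [div_mul_eq_mul_div, div_le_iff₀ (by positivity)]
        refine this.trans ?_
        rw [mul_comm]
        gcongr

/-- Needed for `n = 4`, where no single annulus carries the logarithm but about `log t` of them
contribute equally. -/
theorem le_setIntegral_dyadic {f : EuclideanSpace ℝ (Fin n) → ℝ} (hf : Integrable f) {a κ : ℝ}
    (ha : 0 ≤ a) (N : ℕ)
    (h : ∀ k < N, κ ≤ ∫ ξ in freqAnnulus n (2 ^ k * a) (2 * (2 ^ k * a)), f ξ) :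
    N * κ ≤ ∫ ξ in freqAnnulus n a (2 ^ N * a), f ξ := by
  induction N with
  | zero =>
    have : freqAnnulus n a (2 ^ 0 * a) = ∅ := by
      ext ξ
      simp [freqAnnulus]
    rw [this]
    simp
  | succ N ih =>
    have hle : a ≤ 2 ^ N * a := le_mul_of_one_le_left ha (one_le_pow₀ one_le_two)
    have e : freqAnnulus n a (2 ^ (N + 1) * a)
        = freqAnnulus n a (2 ^ N * a) ∪ freqAnnulus n (2 ^ N * a) (2 * (2 ^ N * a)) := by
      ext ξ
      have e1 : (2 : ℝ) ^ (N + 1) * a = 2 * (2 ^ N * a) := by ring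
      simp only [freqAnnulus, Set.mem_ofPred_eq, Set.mem_union, e1]
      constructor
      · rintro ⟨h1, h2⟩
        rcases lt_or_ge (freqSq ξ) (2 ^ N * a) with h3 | h3
        · exact Or.inl ⟨h1, h3⟩
        · exact Or.inr ⟨h3, h2⟩
      · rintro (⟨h1, h2⟩ | ⟨h1, h2⟩)
        · exact ⟨h1, by linarith⟩
        · exact ⟨by linarith, h2⟩
    have hdisj : Disjoint (freqAnnulus n a (2 ^ N * a))
        (freqAnnulus n (2 ^ N * a) (2 * (2 ^ N * a))) :=
      Set.disjoint_left.2 fun ξ h1 h2 => absurd h1.2 (not_lt.2 h2.1)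
    rw [e, setIntegral_union hdisj (measurableSet_freqAnnulus _ _) hf.integrableOn hf.integrableOn]
    have h1 := ih fun k hk => h k (by omega)
    have h2 := h N (by omega)
    push_cast
    linarith

end Lower

/-! ### Choice of annuli and conclusion -/

section Main

variable {n : ℕ} {σ : ℝ}

theorem rpow_quarter_pow_four {t : ℝ} (ht : 0 ≤ t) : (t ^ (1 / 4 : ℝ)) ^ 4 = t := by
  rw [← Real.rpow_natCast, ← Real.rpow_mul ht]
  norm_num

/-- Lower bound for the mass of the displacement in Fourier variables. -/
theorem exists_eventually_le_integral_plateSymbol_sq (hn : 1 ≤ n) (hσ : 0 < σ) :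
    ∃ c : ℝ, 0 < c ∧ ∀ (y₀ : EuclideanSpace ℝ (Fin n) → ℂ × ℂ × ℂ) (M : ℝ), Continuous y₀ →
      (∀ ξ, ‖(y₀ ξ).1‖ ≤ M) → (∀ ξ, ‖(y₀ ξ).2.2‖ ≤ M) →
      (∀ t, 0 ≤ t → Integrable fun ξ => ‖(plateSymbol σ y₀ t ξ).1‖ ^ 2) →
      ∀ᶠ t : ℝ in atTop, c * rateD n t ^ 2 * ‖(y₀ 0).2.1‖ ^ 2 ≤
        ∫ ξ, ‖(plateSymbol σ y₀ t ξ).1‖ ^ 2 := by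
  obtain ⟨c, hc, hann⟩ := exists_le_setIntegral_plateSymbol hn hσ
  -- For `n ≥ 5` the annulus starts at `a = q²t^(-1/2)`; then `(2a)²t = 4q⁴ = σ/16`, the very edge
  -- of the oscillation zone.
  set q : ℝ := (σ / 64) ^ (1 / 4 : ℝ) with hq
  have hq0 : 0 < q := Real.rpow_pos_of_pos (by positivity) _
  have hq4 : q ^ 4 = σ / 64 := rpow_quarter_pow_four (by positivity)
  set d : ℝ := min (1 / 8) (q ^ n / q ^ 4) with hd
  have hd0 : 0 < d := by positivity
  refine ⟨c * d, by positivity, fun y₀ M hy h0 h2 hint => ?_⟩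
  by_cases hp : (y₀ 0).2.1 = 0
  · refine Eventually.of_forall fun t => ?_
    rw [hp]
    simp only [norm_zero, ne_eq, OfNat.ofNat_ne_zero, not_false_eq_true, zero_pow, mul_zero]
    exact integral_nonneg fun ξ => by positivity
  obtain ⟨δ, hδ, hann⟩ := hann y₀ M hy h0 h2 hp
  set p := ‖(y₀ 0).2.1‖
  have hsub : ∀ t, 0 ≤ t → ∀ a b, ∫ ξ in freqAnnulus n a b, ‖(plateSymbol σ y₀ t ξ).1‖ ^ 2 ≤
      ∫ ξ, ‖(plateSymbol σ y₀ t ξ).1‖ ^ 2 := fun t ht a b =>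
    setIntegral_le_integral (hint t ht) (Eventually.of_forall fun ξ => by positivity)
  have hfin : ∀ t x, x * c * p ^ 2 ≤ ∫ ξ, ‖(plateSymbol σ y₀ t ξ).1‖ ^ 2 →
      d * rateD n t ^ 2 ≤ x →
      c * d * rateD n t ^ 2 * p ^ 2 ≤ ∫ ξ, ‖(plateSymbol σ y₀ t ξ).1‖ ^ 2 := by
    intro t x h1 h2
    refine le_trans ?_ h1
    calc _ = d * rateD n t ^ 2 * c * p ^ 2 := by ring
      _ ≤ _ := by gcongr
  have hquarter : Tendsto (fun t : ℝ => (t ^ (1 / 4 : ℝ)) ^ 2) atTop atTop :=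
    (tendsto_pow_atTop two_ne_zero).comp (tendsto_rpow_atTop (by norm_num))
  rcases Nat.lt_trichotomy n 4 with hn4 | rfl | hn4
  · have hn3 : n ≤ 3 := by omega
    filter_upwards [eventually_ge_atTop 1, eventually_ge_atTop (256 / σ),
      eventually_ge_atTop (4 / δ)] with t ht1 htσ htδ
    have ht0 : 0 < t := by linarith
    rw [div_le_iff₀ hσ] at htσ
    rw [div_le_iff₀ hδ] at htδ
    -- The annulus mass is of order `a^(n/2-2)`, largest for small `a` when `n ≤ 3`; `2/t` is the
    -- smallest value admitted by `2 ≤ a * t`.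
    have h1 := (hann (2 / t) t (by positivity) ht0 (by rw [div_mul_cancel₀ _ ht0.ne']) (by
      have : (2 * (2 / t)) ^ 2 * t = 16 / t := by field_simp; norm_num
      rw [this, div_le_div_iff₀ ht0 (by norm_num)]
      linarith) (by
      rw [← mul_div_assoc, div_le_iff₀ ht0]
      linarith)).trans (hsub t ht0.le _ _)
    refine hfin t (Real.sqrt (2 / t) ^ n / (2 / t) ^ 2) (by linarith) ?_
    rw [rateD_sq_of_le_three hn3 ht0, ← inv_pow, ← Real.sqrt_inv]
    have h3 : Real.sqrt t⁻¹ ^ n ≤ Real.sqrt (2 / t) ^ n := by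
      gcongr
      rw [← one_div]
      gcongr
      norm_num
    have h4 : d ≤ 1 / 4 := (min_le_left _ _).trans (by norm_num)
    calc d * (t ^ 2 * Real.sqrt t⁻¹ ^ n) ≤ 1 / 4 * (t ^ 2 * Real.sqrt (2 / t) ^ n) := by gcongr
      _ = _ := by field_simp; norm_num
  · filter_upwards [eventually_ge_atTop (Real.exp 8), hquarter.eventually_ge_atTop (64 / σ),
      hquarter.eventually_ge_atTop (2 / δ)] with t ht8 htσ htδ
    have ht0 : 0 < t := (Real.exp_pos 8).trans_le ht8
    have hlog : 8 ≤ Real.log t := (Real.le_log_iff_exp_le ht0).2 ht8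
    have ht1 : 1 ≤ t := (Real.one_le_exp (by norm_num)).trans ht8
    set s : ℝ := t ^ (1 / 4 : ℝ) with hs
    have hs0 : 0 < s := Real.rpow_pos_of_pos ht0 _
    have hs1 : 1 ≤ s := Real.one_le_rpow ht1 (by norm_num)
    have hs4 : s ^ 4 = t := rpow_quarter_pow_four ht0.le
    rw [div_le_iff₀ hσ] at htσ
    rw [div_le_iff₀ hδ] at htδ
    -- As `2 ≤ e`, this gives `2^N ≤ t^(1/4)`: the annuli stay below a multiple of `t^(-3/4)`, well
    -- inside the zone `ρ²t ≲ 1`. For `log t ≥ 8` the floor still leaves `N ≥ log t / 8`.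
    set N := ⌊Real.log t / 4⌋₊ with hN
    have hNle : (N : ℝ) ≤ Real.log t / 4 := Nat.floor_le (by linarith)
    have hNge : Real.log t / 4 < N + 1 := Nat.lt_floor_add_one _
    have h2N : (2 : ℝ) ^ N ≤ s := by
      calc (2 : ℝ) ^ N ≤ Real.exp 1 ^ N := by
            gcongr
            linarith [Real.add_one_le_exp 1]
        _ = Real.exp N := by rw [← Real.exp_nat_mul, mul_one]
        _ ≤ Real.exp (Real.log t * (1 / 4)) := Real.exp_le_exp.2 (by linarith)
        _ = s := by rw [hs, Real.rpow_def_of_pos ht0]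
    have h1 := (le_setIntegral_dyadic (hint t ht0.le) (a := 2 / t) (κ := c * p ^ 2)
      (by positivity) N (fun k hk => by
        have hk2 : 2 * (2 ^ k * (2 / t)) ≤ 2 * s / t := by
          have : (2 : ℝ) ^ (k + 1) ≤ 2 ^ N := pow_le_pow_right₀ one_le_two hk
          calc 2 * (2 ^ k * (2 / t)) = 2 * 2 ^ (k + 1) / t := by rw [pow_succ]; ring
            _ ≤ 2 * s / t := by gcongr; exact this.trans h2N
        have h1k : (1 : ℝ) ≤ 2 ^ k := one_le_pow₀ one_le_two
        have h3 := hann (2 ^ k * (2 / t)) t (by positivity) ht0 (by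
          rw [mul_assoc, div_mul_cancel₀ _ ht0.ne']
          linarith) (by
          calc (2 * (2 ^ k * (2 / t))) ^ 2 * t ≤ (2 * s / t) ^ 2 * t := by gcongr
            _ = 4 * s ^ 2 / s ^ 4 := by rw [hs4]; field_simp; norm_num
            _ = 4 / s ^ 2 := by field_simp
            _ ≤ σ / 16 := by
              rw [div_le_div_iff₀ (by positivity) (by norm_num)]
              linarith) (by
          refine hk2.trans ?_
          rw [← hs4, div_le_iff₀ (by positivity)]
          have : s ^ 2 * 2 ≤ s ^ 2 * (s ^ 2 * δ) := by gcongr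
          nlinarith)
        refine le_trans (le_of_eq ?_) h3
        set a := 2 ^ k * (2 / t) with ha
        have ha0 : 0 < a := by positivity
        have : Real.sqrt a ^ 4 = a ^ 2 := by
          rw [show 4 = 2 * 2 by norm_num, pow_mul, Real.sq_sqrt ha0.le]
        rw [this, div_self (by positivity), mul_one])).trans (hsub t ht0.le _ _)
    refine hfin t N (by linarith) ?_
    rw [rateD_four_sq ht1]
    calc d * Real.log t ≤ 1 / 8 * Real.log t := by
          gcongr
          exact min_le_left _ _
      _ ≤ N := by linarith
  · have hn5 : 5 ≤ n := hn4
    filter_upwards [eventually_gt_atTop 0, hquarter.eventually_ge_atTop (2 / q ^ 2),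
      hquarter.eventually_ge_atTop (2 * q ^ 2 / δ)] with t ht0 htq htδ
    set s : ℝ := t ^ (1 / 4 : ℝ) with hs
    have hs0 : 0 < s := Real.rpow_pos_of_pos ht0 _
    have hs4 : s ^ 4 = t := rpow_quarter_pow_four ht0.le
    rw [div_le_iff₀ (by positivity)] at htq
    rw [div_le_iff₀ hδ] at htδ
    have h1 := (hann ((q / s) ^ 2) t (by positivity) ht0 (by
      rw [← hs4]
      have : (q / s) ^ 2 * s ^ 4 = s ^ 2 * q ^ 2 := by field_simp
      rw [this]
      exact htq) (by
      rw [← hs4]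
      have : (2 * (q / s) ^ 2) ^ 2 * s ^ 4 = 4 * q ^ 4 := by field_simp; norm_num
      rw [this, hq4]
      linarith) (by
      rw [div_pow, ← mul_div_assoc, div_le_iff₀ (by positivity)]
      linarith)).trans (hsub t ht0.le _ _)
    rw [Real.sqrt_sq (by positivity)] at h1
    refine hfin t ((q / s) ^ n / ((q / s) ^ 2) ^ 2) (by linarith) ?_
    rw [rateD_sq_of_five_le hn5 ht0, ← hs]
    calc d * (t * (s ^ n)⁻¹) ≤ q ^ n / q ^ 4 * (t * (s ^ n)⁻¹) := by
          gcongr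
          exact min_le_right _ _
      _ = _ := by rw [← hs4, div_pow]; field_simp

theorem fourier_zero_eq_integral (f : EuclideanSpace ℝ (Fin n) → ℂ) : 𝓕 f 0 = ∫ x, f x := by
  simp [Real.fourier_eq]

theorem integrable_and_integral_norm_fourier_sq
    {f : Lp ℂ 2 (volume : Measure (EuclideanSpace ℝ (Fin n)))} (hf : Integrable f) :
    (Integrable fun ξ => ‖𝓕 (f : EuclideanSpace ℝ (Fin n) → ℂ) ξ‖ ^ 2) ∧
    ∫ ξ, ‖𝓕 (f : EuclideanSpace ℝ (Fin n) → ℂ) ξ‖ ^ 2 = ‖f‖ ^ 2 := by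
  have h : (fun ξ => ‖(𝓕 f : Lp ℂ 2 _) ξ‖ ^ 2) =ᵐ[volume]
      fun ξ => ‖𝓕 (f : EuclideanSpace ℝ (Fin n) → ℂ) ξ‖ ^ 2 := by
    filter_upwards [fourier_ae_eq hf] with ξ hξ
    rw [hξ]
  constructor
  · exact ((Lp.memLp (𝓕 f : Lp ℂ 2 _)).integrable_norm_pow two_ne_zero).congr h
  · rw [← integral_congr_ae h, ← lp_two_norm_sq_eq_integral, Lp.norm_fourier_eq]

theorem norm_le_normL2L1 (f : Lp ℂ 2 (volume : Measure (EuclideanSpace ℝ (Fin n)))) :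
    ‖f‖ ≤ normL2L1 f :=
  le_add_of_nonneg_right (integral_nonneg fun _ => norm_nonneg _)

theorem integral_norm_le_normL2L1 (f : Lp ℂ 2 (volume : Measure (EuclideanSpace ℝ (Fin n)))) :
    ∫ x, ‖f x‖ ≤ normL2L1 f :=
  le_add_of_nonneg_left (norm_nonneg _)

end Main

/-- Optimal large-time estimates for the vertical displacement of the thermoelastic plate system with
Newton's law of cooling. The constants `c`, `C` and the time `T` depend on `n` and `σ` only; in the
lower bound the time from which it holds may depend on the solution. -/
theorem theorem2p1 (n : ℕ) (hn : 1 ≤ n) (σ : ℝ) (hσ : 0 < σ) :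
    ∃ c C T : ℝ, 0 < c ∧ 0 < C ∧
      ∀ (u₀ u₁ θ₀ : Lp ℂ 2 (volume : Measure (EuclideanSpace ℝ (Fin n))))
        (_hu₀ : Integrable u₀ volume) (_hu₁ : Integrable u₁ volume) (_hθ₀ : Integrable θ₀ volume)
        (u : ℝ → Lp ℂ 2 (volume : Measure (EuclideanSpace ℝ (Fin n))))
        (ut θ : ℝ → 𝓢'(EuclideanSpace ℝ (Fin n), ℂ))
        (_hsol : IsThermoelasticPlateSolution σ u₀ u₁ θ₀ u ut θ),
        (∀ t : ℝ, T ≤ t →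
          ‖u t‖ ≤ C * rateD n t * (normL2L1 u₀ + normL2L1 u₁ + normL2L1 θ₀)) ∧
        (∀ᶠ t : ℝ in atTop, c * rateD n t * ‖∫ x, u₁ x‖ ≤ ‖u t‖) ∧
        ((∫ x, u₁ x) ≠ 0 → (fun t => ‖u t‖) =Θ[atTop] rateD n) := by
  obtain ⟨c, hc, hlow⟩ := exists_eventually_le_integral_plateSymbol_sq hn hσ
  obtain ⟨C, T, hC, hup⟩ := exists_integral_plateSymbol_sq_le hn hσ
  refine ⟨Real.sqrt c, Real.sqrt C, max T 0, Real.sqrt_pos.2 hc, Real.sqrt_pos.2 hC, ?_⟩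
  intro u₀ u₁ θ₀ hu₀ hu₁ hθ₀ u ut θ hsol
  have hy := continuous_fourierData hu₀ hu₁ hθ₀
  have hae : ∀ t, 0 ≤ t → (fun ξ => ‖(𝓕 (u t) : Lp ℂ 2 _) ξ‖ ^ 2) =ᵐ[volume]
      fun ξ => ‖(plateSymbol σ (fourierData u₀ u₁ θ₀) t ξ).1‖ ^ 2 := fun t ht => by
    filter_upwards [hsol.fourier_ae_eq hσ.le hu₀ hu₁ hθ₀ ht] with ξ hξ
    rw [hξ]
  have hnorm : ∀ t, 0 ≤ t → ‖u t‖ ^ 2 =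
      ∫ ξ, ‖(plateSymbol σ (fourierData u₀ u₁ θ₀) t ξ).1‖ ^ 2 := fun t ht => by
    rw [← Lp.norm_fourier_eq, lp_two_norm_sq_eq_integral, integral_congr_ae (hae t ht)]
  have hint : ∀ t, 0 ≤ t → Integrable fun ξ =>
      ‖(plateSymbol σ (fourierData u₀ u₁ θ₀) t ξ).1‖ ^ 2 := fun t ht =>
    ((Lp.memLp (𝓕 (u t) : Lp ℂ 2 _)).integrable_norm_pow two_ne_zero).congr (hae t ht)
  -- Serves as the bound `M` of both estimates: it dominates the sup norms of the transforms by the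
  -- `L¹` parts and their mean squares by the `L²` parts.
  set S := normL2L1 u₀ + normL2L1 u₁ + normL2L1 θ₀ with hS
  have p₀ := (norm_nonneg _).trans (norm_le_normL2L1 u₀)
  have p₁ := (norm_nonneg _).trans (norm_le_normL2L1 u₁)
  have p₂ := (norm_nonneg _).trans (norm_le_normL2L1 θ₀)
  have hS0 : 0 ≤ S := by positivity
  have b₀ : ∀ ξ, ‖(fourierData u₀ u₁ θ₀ ξ).1‖ ≤ S := fun ξ =>
    (norm_fourier_le_integral_norm _ ξ).trans
      ((integral_norm_le_normL2L1 u₀).trans (by linarith))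
  have b₁ : ∀ ξ, ‖(fourierData u₀ u₁ θ₀ ξ).2.1‖ ≤ S := fun ξ =>
    (norm_fourier_le_integral_norm _ ξ).trans
      ((integral_norm_le_normL2L1 u₁).trans (by linarith))
  have b₂ : ∀ ξ, ‖(fourierData u₀ u₁ θ₀ ξ).2.2‖ ≤ S := fun ξ =>
    (norm_fourier_le_integral_norm _ ξ).trans
      ((integral_norm_le_normL2L1 θ₀).trans (by linarith))
  obtain ⟨i₀, e₀⟩ := integrable_and_integral_norm_fourier_sq hu₀
  obtain ⟨i₁, e₁⟩ := integrable_and_integral_norm_fourier_sq hu₁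
  obtain ⟨i₂, e₂⟩ := integrable_and_integral_norm_fourier_sq hθ₀
  have hmass : ∫ ξ, (‖(fourierData u₀ u₁ θ₀ ξ).1‖ ^ 2 + ‖(fourierData u₀ u₁ θ₀ ξ).2.1‖ ^ 2
      + ‖(fourierData u₀ u₁ θ₀ ξ).2.2‖ ^ 2) ≤ 3 * S ^ 2 := by
    have h₀ : ‖u₀‖ ≤ S := (norm_le_normL2L1 u₀).trans (by linarith)
    have h₁ : ‖u₁‖ ≤ S := (norm_le_normL2L1 u₁).trans (by linarith)
    have h₂ : ‖θ₀‖ ≤ S := (norm_le_normL2L1 θ₀).trans (by linarith)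
    simp only [fourierData]
    have i₀₁ : Integrable fun ξ => ‖𝓕 (u₀ : EuclideanSpace ℝ (Fin n) → ℂ) ξ‖ ^ 2
        + ‖𝓕 (u₁ : EuclideanSpace ℝ (Fin n) → ℂ) ξ‖ ^ 2 := i₀.add i₁
    rw [integral_add i₀₁ i₂, integral_add i₀ i₁, e₀, e₁, e₂]
    calc _ ≤ S ^ 2 + S ^ 2 + S ^ 2 := by gcongr
      _ = _ := by ring
  have hupper : ∀ t, max T 0 ≤ t → ‖u t‖ ≤ Real.sqrt C * rateD n t * S := by
    intro t ht
    have ht0 : 0 ≤ t := (le_max_right _ _).trans ht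
    have h := hup t ((le_max_left _ _).trans ht) _ S b₀ b₁ b₂ ((i₀.add i₁).add i₂) hmass
    rw [← hnorm t ht0] at h
    have hD := rateD_nonneg n ht0
    refine (sq_le_sq₀ (norm_nonneg _) (by positivity)).1 (h.trans (le_of_eq ?_))
    rw [mul_pow, mul_pow, Real.sq_sqrt hC.le]
  have hlower : ∀ᶠ t : ℝ in atTop, Real.sqrt c * rateD n t * ‖∫ x, u₁ x‖ ≤ ‖u t‖ := by
    filter_upwards [hlow _ S hy b₀ b₂ hint, eventually_ge_atTop 0] with t ht ht0
    rw [← hnorm t ht0] at ht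
    have hD := rateD_nonneg n ht0
    have e : ‖(fourierData u₀ u₁ θ₀ 0).2.1‖ = ‖∫ x, u₁ x‖ := by
      simp only [fourierData, fourier_zero_eq_integral]
    rw [e] at ht
    refine (sq_le_sq₀ (by positivity) (norm_nonneg _)).1 (le_trans (le_of_eq ?_) ht)
    rw [mul_pow, mul_pow, Real.sq_sqrt hc.le]
  refine ⟨hupper, hlower, fun hP => ⟨?_, ?_⟩⟩
  · refine IsBigO.of_bound (Real.sqrt C * S) ?_
    filter_upwards [eventually_ge_atTop (max T 0)] with t ht
    rw [norm_norm, Real.norm_of_nonneg (rateD_nonneg n ((le_max_right _ _).trans ht))]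
    exact (hupper t ht).trans (le_of_eq (by ring))
  · have hP0 : 0 < ‖∫ x, u₁ x‖ := norm_pos_iff.2 hP
    refine IsBigO.of_bound (Real.sqrt c * ‖∫ x, u₁ x‖)⁻¹ ?_
    filter_upwards [hlower, eventually_ge_atTop 0] with t ht ht0
    rw [norm_norm, Real.norm_of_nonneg (rateD_nonneg n ht0), inv_mul_eq_div,
      le_div_iff₀ (mul_pos (Real.sqrt_pos.2 hc) hP0)]
    linarith
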